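/- Let $\lambda_{BS}>0$, $0<p\le 1$, $D>0$, $\beta\in\mathbb{R}$, and for $j\in\{L,N\}$ (line of sight / non line of sight) let $\alpha_j>0$ and $\xi_j>0$. Let $\Phi_L$ and $\Phi_N$ be Poisson point processes on $\mathbb{R}^2$ with intensity functions $\lambda_{BS}\,p\,\mathbf 1_{\{\|x\|\le D\}}$ and $\lambda_{BS}(1-p)\mathbf 1_{\{\|x\|\le D\}}+\lambda_{BS}\mathbf 1_{\{\|x\|>D\}}$, respectively. For each $j$, let the points $y\in\Phi_j$ carry i.i.d. marks $\chi_{y,j}\sim N(0,\xi_j^2)$, independent of $\Phi_j$, put $S_{y,j}=10^{-(\beta+\chi_{y,j})/10}$, and let $\mathcal N_j=\{\|y\|^{\alpha_j}/S_{y,j}: y\in\Phi_j\}\subset[0,\infty)$ be the propagation process. Let $Q$ be the complementary distribution function of the standard Gaussian law, $m=-0.1\,\beta\ln 10$, $\sigma_j=0.1\,\xi_j\ln 10$, $\Upsilon_j(t)=\bigl(\ln(D^{\alpha_j}/t)-m\bigr)/\sigma_j$, $c_j=\exp\bigl(\tfrac{2\sigma_j^2}{\alpha_j^2}+\tfrac{2m}{\alpha_j}\bigr)$,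 and for $t>0$ $$M_L(t)=\pi p\Bigl[D^2Q(\Upsilon_L(t))+t^{2/\alpha_L}c_L\,Q\bigl(\tfrac{2\sigma_L^2}{\alpha_L\sigma_L}-\Upsilon_L(t)\bigr)\Bigr],$$ $$M_N(t)=-\pi pD^2Q(\Upsilon_N(t))+\pi t^{2/\alpha_N}c_N\Bigl[1-p\,Q\bigl(\tfrac{2\sigma_N^2}{\alpha_N\sigma_N}-\Upsilon_N(t)\bigr)\Bigr].$$ Let $B_j=\mathbb P(\mathcal N_j\neq\emptyset)$. Then $B_L=1-e^{-\lambda_{BS}\pi pD^2}$ and $B_N=1$. The functions $M_L,M_N$ are differentiable on $(0,\infty)$ with derivatives $$M_L'(t)=\pi p\Bigl\{c_L\,t^{\frac{2}{\alpha_L}-1}\Bigl[\tfrac{2}{\alpha_L}Q\bigl(\tfrac{2\sigma_L^2}{\alpha_L\sigma_L}-\Upsilon_L(t)\bigr)-\tfrac{1}{\sqrt{2\pi\sigma_L^2}}e^{-\left(\frac{\sqrt2\sigma_L}{\alpha_L}-\frac{\Upsilon_L(t)}{\sqrt2}\right)^2}\Bigr]+\tfrac{D^2}{\sqrt{2\pi}\,t\,\sigma_L}e^{-\Upsilon_L(t)^2/2}\Bigr\},$$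 $$M_N'(t)=\pi p\Bigl\{c_N\,t^{\frac{2}{\alpha_N}-1}\Bigl[\tfrac{2}{p\alpha_N}-\tfrac{2}{\alpha_N}Q\bigl(\tfrac{2\sigma_N^2}{\alpha_N\sigma_N}-\Upsilon_N(t)\bigr)+\tfrac{1}{\sqrt{2\pi\sigma_N^2}}e^{-\left(\frac{\sqrt2\sigma_N}{\alpha_N}-\frac{\Upsilon_N(t)}{\sqrt2}\right)^2}\Bigr]-\tfrac{D^2}{\sqrt{2\pi}\,t\,\sigma_N}e^{-\Upsilon_N(t)^2/2}\Bigr\}.$$ Moreover, for $j=L$ (resp. $j=N$), conditionally on $\mathcal N_j\neq\emptyset$, almost surely $\mathcal N_j$ has a point nearest to the origin, and its distance to the origin has, on $(0,\infty)$, the probability density function $$f_j(t)=\lambda_{BS}\exp\bigl(-\lambda_{BS}M_j(t)\bigr)\,M_j'(t)/B_j .$$ -/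

import Mathlib

open MeasureTheory ProbabilityTheory

noncomputable section

namespace MmWave

/-- State of a link: line of sight or non line of sight. -/
inductive LinkType where
  | LOS
  | NLOS

/-- Numerical parameters of the network. -/
structure Params where
  /-- density of the base stations -/
  lam : ℝ
  /-- probability that a link of length at most `D` is line of sight -/
  p : ℝ
  /-- radius beyond which every link is non line of sight -/
  D : ℝ
  /-- path loss in dB at the reference distance 1 -/
  beta : ℝ
  /-- path loss exponents -/
  alpha : LinkType → ℝ
  /-- standard deviations (in dB) of the shadowing -/
  xi : LinkType → ℝ

/-- The plane in which the base stations lie; the typical user is at the origin. -/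
abbrev Plane := EuclideanSpace ℝ (Fin 2)

/-! ### Poisson point processes -/

/-- A random, finite or infinite, sequence of points of `E`: the points are `pt n ω` for the
indices `n` with `n < num ω` (the values `pt n ω` for `n ≥ num ω` are not used). -/
structure RandomPoints (Ω E : Type*) where
  /-- the total number of points -/
  num : Ω → ℕ∞
  /-- the points -/
  pt : ℕ → Ω → E

/-- Number of points in the set `A`. -/
def RandomPoints.count {Ω E : Type*} (Φ : RandomPoints Ω E) (A : Set E) (ω : Ω) : ℕ∞ :=
  {n : ℕ | (n : ℕ∞) < Φ.num ω ∧ Φ.pt n ω ∈ A}.encard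

/-- `Φ` is a Poisson point process with intensity measure `Λ`: the numbers of points in
measurable sets of finite intensity are Poisson distributed with mean the intensity of the set,
and the numbers of points in disjoint measurable sets are independent. -/
structure IsPoissonProcess {Ω E : Type*} [MeasurableSpace Ω] [MeasurableSpace E]
    (Φ : RandomPoints Ω E) (Λ : Measure E) (μ : Measure Ω) : Prop where
  measurable_num : Measurable Φ.num
  measurable_pt : ∀ n, Measurable (Φ.pt n)
  map_count : ∀ A : Set E, MeasurableSet A → Λ A ≠ ⊤ →
    μ.map (Φ.count A) = (poissonMeasure (Λ A).toNNReal).map (fun k : ℕ => (k : ℕ∞))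
  indep_count : ∀ (k : ℕ) (A : Fin k → Set E), (∀ i, MeasurableSet (A i)) →
    Pairwise (fun i i' => Disjoint (A i) (A i')) → iIndepFun (fun i => Φ.count (A i)) μ

/-- The sequence `χ` consists of independent real marks with common law `ν`, and it is independent
of the points `Φ`. -/
structure IsIndepMarking {Ω E : Type*} [MeasurableSpace Ω] [MeasurableSpace E]
    (Φ : RandomPoints Ω E) (χ : ℕ → Ω → ℝ) (ν : Measure ℝ) (μ : Measure Ω) : Prop where
  measurable_mark : ∀ n, Measurable (χ n)
  map_mark : ∀ n, μ.map (χ n) = ν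
  iIndep_mark : iIndepFun χ μ
  indep_points : IndepFun (fun ω => (Φ.num ω, fun n => Φ.pt n ω)) (fun ω n => χ n ω) μ

/-! ### Base stations and propagation losses -/

/-- Intensity function of the base stations of type `j`:
`λ p 1{‖x‖ ≤ D}` for LOS, and `λ (1 - p) 1{‖x‖ ≤ D} + λ 1{‖x‖ > D}` for NLOS. -/
def density (P : Params) : LinkType → Plane → ℝ
  | .LOS, x => if ‖x‖ ≤ P.D then P.lam * P.p else 0
  | .NLOS, x => if ‖x‖ ≤ P.D then P.lam * (1 - P.p) else P.lam

/-- Intensity measure of the base stations of type `j`. -/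
def intensity (P : Params) (j : LinkType) : Measure Plane :=
  (volume : Measure Plane).withDensity (fun x => ENNReal.ofReal (density P j x))

/-- `Φ` is the process of the base stations of type `j`, and `χ n` is the shadowing in dB, with law
`N(0, ξ_j ^ 2)`, on the link from its `n`-th point to the origin. -/
structure IsBSProcess {Ω : Type*} [MeasurableSpace Ω] (P : Params) (j : LinkType)
    (Φ : RandomPoints Ω Plane) (χ : ℕ → Ω → ℝ) (μ : Measure Ω) : Prop where
  poisson : IsPoissonProcess Φ (intensity P j) μ
  marking : IsIndepMarking Φ χ (gaussianReal 0 (P.xi j ^ 2).toNNReal) μ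

/-- The lognormal gain in linear scale: `S = 10 ^ (-(β + χ) / 10)` when the shadowing is `χ` dB. -/
def gain (P : Params) (s : ℝ) : ℝ := (10 : ℝ) ^ (-(P.beta + s) / 10)

/-- Propagation loss `‖x‖ ^ α_j / S` of the link from `x` to the origin, in linear scale. -/
def loss (P : Params) (j : LinkType) (x : Plane) (s : ℝ) : ℝ := ‖x‖ ^ P.alpha j / gain P s

/-- The propagation process: the set of the propagation losses of all points of `Φ`. -/
def propagation {Ω : Type*} (P : Params) (j : LinkType) (Φ : RandomPoints Ω Plane)
    (χ : ℕ → Ω → ℝ) (ω : Ω) : Set ℝ :=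
  {l | ∃ n : ℕ, (n : ℕ∞) < Φ.num ω ∧ l = loss P j (Φ.pt n ω) (χ n ω)}

/-- The event that the propagation process is not empty. -/
def nonemptyEvent {Ω : Type*} (P : Params) (j : LinkType) (Φ : RandomPoints Ω Plane)
    (χ : ℕ → Ω → ℝ) : Set Ω :=
  {ω | (propagation P j Φ χ ω).Nonempty}

/-- The distance from the origin to the nearest point of the propagation process (a subset of
`[0, ∞)`). -/
def nearest {Ω : Type*} (P : Params) (j : LinkType) (Φ : RandomPoints Ω Plane)
    (χ : ℕ → Ω → ℝ) (ω : Ω) : ℝ :=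
  sInf (propagation P j Φ χ ω)

/-! ### The explicit functions -/

/-- The Q-function, that is the complementary distribution function of the standard Gaussian. -/
def Q (x : ℝ) : ℝ := (gaussianReal 0 1).real (Set.Ioi x)

/-- `m = -0.1 β ln 10`. -/
def m (P : Params) : ℝ := -(1 / 10) * P.beta * Real.log 10

/-- `σ_j = 0.1 ξ_j ln 10`. -/
def sigma (P : Params) (j : LinkType) : ℝ := (1 / 10) * P.xi j * Real.log 10

/-- `Υ_j(t) = (ln (D ^ α_j / t) - m) / σ_j`. -/
def Upsilon (P : Params) (j : LinkType) (t : ℝ) : ℝ :=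
  (Real.log (P.D ^ P.alpha j / t) - m P) / sigma P j

/-- `exp (2 σ_j ^ 2 / α_j ^ 2 + 2 m / α_j)`. -/
def expConst (P : Params) (j : LinkType) : ℝ :=
  Real.exp (2 * sigma P j ^ 2 / P.alpha j ^ 2 + 2 * m P / P.alpha j)

/-- `Q (2 σ_j ^ 2 / (α_j σ_j) - Υ_j(t))`. -/
def qShift (P : Params) (j : LinkType) (t : ℝ) : ℝ :=
  Q (2 * sigma P j ^ 2 / (P.alpha j * sigma P j) - Upsilon P j t)

/-- The functions `M_L` and `M_N`. -/
def M (P : Params) : LinkType → ℝ → ℝ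
  | .LOS, t => Real.pi * P.p *
      (P.D ^ 2 * Q (Upsilon P .LOS t)
        + t ^ (2 / P.alpha .LOS) * expConst P .LOS * qShift P .LOS t)
  | .NLOS, t => -(Real.pi * P.p * P.D ^ 2 * Q (Upsilon P .NLOS t))
      + Real.pi * t ^ (2 / P.alpha .NLOS) * expConst P .NLOS * (1 - P.p * qShift P .NLOS t)

/-- `(2 π σ_j ^ 2) ^ (-1/2) exp (-(√2 σ_j / α_j - Υ_j(t) / √2) ^ 2)`. -/
def gaussTerm (P : Params) (j : LinkType) (t : ℝ) : ℝ :=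
  1 / √(2 * Real.pi * sigma P j ^ 2)
    * Real.exp (-(√2 * sigma P j / P.alpha j - Upsilon P j t / √2) ^ 2)

/-- `D ^ 2 / (√(2 π) t σ_j) exp (-Υ_j(t) ^ 2 / 2)`. -/
def edgeTerm (P : Params) (j : LinkType) (t : ℝ) : ℝ :=
  P.D ^ 2 / (√(2 * Real.pi) * t * sigma P j) * Real.exp (-Upsilon P j t ^ 2 / 2)

/-- The explicit functions `M'_L` and `M'_N`. -/
def M' (P : Params) : LinkType → ℝ → ℝ
  | .LOS, t => Real.pi * P.p *
      (expConst P .LOS * t ^ (2 / P.alpha .LOS - 1)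
          * (2 / P.alpha .LOS * qShift P .LOS t - gaussTerm P .LOS t)
        + edgeTerm P .LOS t)
  | .NLOS, t => Real.pi * P.p *
      (expConst P .NLOS * t ^ (2 / P.alpha .NLOS - 1)
          * (2 / (P.p * P.alpha .NLOS) - 2 / P.alpha .NLOS * qShift P .NLOS t
              + gaussTerm P .NLOS t)
        - edgeTerm P .NLOS t)

/-- Value of the probability that the propagation process of type `j` is not empty:
`B_L = 1 - exp (-λ π p D ^ 2)` and `B_N = 1`. -/
def B (P : Params) : LinkType → ℝ
  | .LOS => 1 - Real.exp (-(P.lam * Real.pi * P.p * P.D ^ 2))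
  | .NLOS => 1

/-- `f_j(t) = λ exp (-λ M_j(t)) M'_j(t) / B_j`, the density on `(0, ∞)`. -/
def f (P : Params) (j : LinkType) (t : ℝ) : ℝ :=
  P.lam * Real.exp (-(P.lam * M P j t)) * M' P j t / B P j

end MmWave

end

namespace MmWave

open Filter Topology Set
open scoped ENNReal NNReal

/-! ### Void probabilities of independently marked Poisson processes -/

section Poisson

/-! A point and its mark give a loss at most `t` exactly when the pair lies in a sublevel set `T` of
the loss in `Plane × ℝ`. So the law of the nearest point is governed by the probability that no
marked point lies in `T`, which is `exp (-ρ T)` with `ρ` the product of the intensity and the mark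
law (`IsIndepMarking.measure_void`).

Only the unmarked counts are assumed Poisson. Integrating out the marks turns the void probability
into the mean of the product of `1 - ν (T_x)` over the points `x`, where `T_x` is the section of `T`
at `x`. This is a probability generating functional, computed first for simple functions, from the
independent Poisson counts on their level sets, and then by monotone limits.

For a fixed mark, the section of `T` is a disk with lognormal squared radius. Its intensity is
affine in the squared radius and in the squared radius capped at `D ^ 2`. The Gaussian mean of these
two gives `ρ T = λ M_j(t)` (`prod_loss_le`).

Since `ρ T` is finite, almost surely finitely many points have loss at most `t`, so the infimum is
attained and the distribution function is `(1 - exp (-λ M_j(t))) / B_j` for `t > 0`. Its derivative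
is `f_j`, and `M_j(0+) = 0` excludes an atom at the origin. -/

lemma lintegral_one_sub_pow_poissonMeasure (r : ℝ≥0) {c : ℝ≥0∞} (hc : c ≤ 1) :
    ∫⁻ k : ℕ, (1 - c) ^ k ∂(poissonMeasure r) =
      ENNReal.ofReal (Real.exp (-(c * r).toReal)) := by
  lift c to ℝ≥0 using ne_top_of_le_ne_top ENNReal.one_ne_top hc
  have hc' : (c : ℝ) ≤ 1 := by exact_mod_cast hc
  have h1 : (1 - (c : ℝ≥0∞)) = ENNReal.ofReal (1 - c) := by
    rw [ENNReal.ofReal_sub _ c.coe_nonneg]; simp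
  have h0 : (0 : ℝ) ≤ 1 - c := by linarith
  have hs : HasSum (fun k : ℕ => (1 - (c : ℝ)) ^ k * (Real.exp (-r) * r ^ k / k.factorial))
      (Real.exp (-(c * r))) := by
    have := (NormedSpace.expSeries_div_hasSum_exp ((1 - (c : ℝ)) * r)).mul_left (Real.exp (-r))
    rw [← Real.exp_eq_exp_ℝ, ← Real.exp_add] at this
    have he : -(r : ℝ) + (1 - c) * r = -(c * r) := by ring
    rw [he] at this
    have hf : (fun k : ℕ => (1 - (c : ℝ)) ^ k * (Real.exp (-r) * r ^ k / k.factorial)) =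
        fun k : ℕ => Real.exp (-r) * (((1 - (c : ℝ)) * r) ^ k / k.factorial) := by
      funext k; rw [mul_pow]; ring
    rwa [hf]
  rw [lintegral_countable']
  simp_rw [poissonMeasure_singleton, h1, ← ENNReal.ofReal_pow h0]
  have : ∀ k : ℕ, ENNReal.ofReal ((1 - (c : ℝ)) ^ k) *
      ENNReal.ofReal (Real.exp (-r) * r ^ k / k.factorial) =
      ENNReal.ofReal ((1 - (c : ℝ)) ^ k * (Real.exp (-r) * r ^ k / k.factorial)) := fun k => by
    rw [ENNReal.ofReal_mul (by positivity)]
  simp_rw [this]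
  rw [← ENNReal.ofReal_tsum_of_nonneg (fun k => by positivity) hs.summable, hs.tsum_eq]
  simp

section Combinatorial

variable {Ω E : Type*}

/-- Product of `g` over those of the first `N` points that are present. -/
noncomputable def RandomPoints.partialProd (Φ : RandomPoints Ω E) (g : E → ℝ≥0∞) (N : ℕ) (ω : Ω) :
    ℝ≥0∞ :=
  ∏ n ∈ Finset.range N, if (n : ℕ∞) < Φ.num ω then g (Φ.pt n ω) else 1

lemma RandomPoints.antitone_partialProd (Φ : RandomPoints Ω E) {g : E → ℝ≥0∞} (hg : ∀ x, g x ≤ 1)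
    (ω : Ω) : Antitone (fun N => Φ.partialProd g N ω) := by
  refine antitone_nat_of_succ_le fun N => ?_
  rw [partialProd, Finset.prod_range_succ]
  refine mul_le_of_le_one_right' ?_
  split_ifs
  · exact hg _
  · exact le_rfl

lemma RandomPoints.partialProd_mono (Φ : RandomPoints Ω E) {g g' : E → ℝ≥0∞}
    (h : ∀ x, g x ≤ g' x) (N : ℕ) (ω : Ω) : Φ.partialProd g N ω ≤ Φ.partialProd g' N ω := by
  refine Finset.prod_le_prod' fun n _ => ?_
  split_ifs
  · exact h _
  · exact le_rfl

lemma RandomPoints.partialProd_le_one (Φ : RandomPoints Ω E) {g : E → ℝ≥0∞} (hg : ∀ x, g x ≤ 1)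
    (N : ℕ) (ω : Ω) : Φ.partialProd g N ω ≤ 1 := by
  refine Finset.prod_le_one' fun n _ => ?_
  split_ifs
  · exact hg _
  · exact le_rfl

/-- The marked point process has no point in `T`. -/
def RandomPoints.voidEvent (Φ : RandomPoints Ω E) (χ : ℕ → Ω → ℝ) (T : Set (E × ℝ)) : Set Ω :=
  {ω | ∀ n : ℕ, (n : ℕ∞) < Φ.num ω → (Φ.pt n ω, χ n ω) ∉ T}

lemma RandomPoints.voidEvent_eq_iInter (Φ : RandomPoints Ω E) (χ : ℕ → Ω → ℝ) (T : Set (E × ℝ)) :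
    Φ.voidEvent χ T = ⋂ N : ℕ, {ω | ∀ n < N, (n : ℕ∞) < Φ.num ω → (Φ.pt n ω, χ n ω) ∉ T} := by
  ext ω
  simp only [voidEvent, mem_ofPred_eq, mem_iInter]
  exact ⟨fun h N n _ => h n, fun h n => h (n + 1) n n.lt_succ_self⟩

lemma measurableSet_lt_num [MeasurableSpace Ω] {Φ : RandomPoints Ω E} (hn : Measurable Φ.num) (n : ℕ) :
    MeasurableSet {ω | (n : ℕ∞) < Φ.num ω} :=
  hn (MeasurableSet.of_discrete (s := Ioi (n : ℕ∞)))

end Combinatorial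

/-! ### Generating functional of an unmarked Poisson process. -/

variable {Ω E : Type*} [MeasurableSpace Ω] [MeasurableSpace E]
  {Φ : RandomPoints Ω E} {Λ : Measure E} {μ : Measure Ω}

lemma IsPoissonProcess.measurable_partialProd (h : IsPoissonProcess Φ Λ μ) {g : E → ℝ≥0∞}
    (hg : Measurable g) (N : ℕ) : Measurable (Φ.partialProd g N) :=
  Finset.measurable_prod _ fun n _ =>
    Measurable.ite (measurableSet_lt_num h.measurable_num n)
      (hg.comp (h.measurable_pt n)) measurable_const

lemma IsPoissonProcess.measurable_count (h : IsPoissonProcess Φ Λ μ) {A : Set E}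
    (hA : MeasurableSet A) : Measurable (Φ.count A) := by
  refine measurable_encard.comp (measurable_set_iff.2 fun n => measurableSet_setOfPred.1 ?_)
  exact (measurableSet_lt_num h.measurable_num n).inter (h.measurable_pt n hA)

lemma IsPoissonProcess.ae_count_ne_top (h : IsPoissonProcess Φ Λ μ) {A : Set E}
    (hA : MeasurableSet A) (hfin : Λ A ≠ ⊤) : ∀ᵐ ω ∂μ, Φ.count A ω ≠ ⊤ := by
  have h1 : ∀ᵐ x ∂(μ.map (Φ.count A)), x ≠ ⊤ := by
    rw [h.map_count A hA hfin, ae_map_iff (by fun_prop) (MeasurableSet.of_discrete)]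
    simp
  exact ae_of_ae_map (h.measurable_count hA).aemeasurable h1

lemma IsPoissonProcess.lintegral_one_sub_pow_count (h : IsPoissonProcess Φ Λ μ) {A : Set E}
    (hA : MeasurableSet A) (hfin : Λ A ≠ ⊤) {c : ℝ≥0∞} (hc : c ≤ 1) :
    ∫⁻ ω, (1 - c) ^ (Φ.count A ω).toNat ∂μ = ENNReal.ofReal (Real.exp (-(c * Λ A).toReal)) := by
  have : ∫⁻ x, (1 - c) ^ (x : ℕ∞).toNat ∂(μ.map (Φ.count A)) =
      ENNReal.ofReal (Real.exp (-(c * Λ A).toReal)) := by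
    rw [h.map_count A hA hfin, lintegral_map (measurable_of_countable _) (by fun_prop)]
    simp only [ENat.toNat_natCast]
    rw [lintegral_one_sub_pow_poissonMeasure _ hc, ENNReal.coe_toNNReal hfin]
  rw [← this, lintegral_map (measurable_of_countable _) (h.measurable_count hA)]

/-- Points where `s` vanishes contribute a factor 1, and there may be infinitely many of them, so
the value 0 is erased. The finitely many others have bounded index: the partial products are
eventually constant and can be grouped by the value of `s`. -/
lemma RandomPoints.iInf_partialProd_simpleFunc {Ω : Type*} (Φ : RandomPoints Ω E) (s : SimpleFunc E ℝ≥0∞)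
    {ω : Ω}
    (hω : ∀ c ∈ s.range.erase 0, Φ.count (s ⁻¹' {c}) ω ≠ ⊤) :
    ⨅ N, Φ.partialProd (fun x => 1 - s x) N ω =
      ∏ c ∈ s.range.erase 0, (1 - c) ^ (Φ.count (s ⁻¹' {c}) ω).toNat := by
  classical
  have hfin : ∀ c ∈ s.range.erase 0,
      {n : ℕ | (n : ℕ∞) < Φ.num ω ∧ Φ.pt n ω ∈ s ⁻¹' {c}}.Finite := fun c hc => by
    have := hω c hc
    rwa [RandomPoints.count, Ne, encard_eq_top_iff, not_infinite] at this
  obtain ⟨N₀, hN₀⟩ := ((s.range.erase 0).finite_toSet.biUnion hfin).bddAbove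
  refine tendsto_nhds_unique (tendsto_atTop_iInf
    (Φ.antitone_partialProd (fun x => tsub_le_self) ω)) ?_
  refine tendsto_const_nhds.congr' ?_
  filter_upwards [eventually_gt_atTop N₀] with N hN
  rw [partialProd, ← Finset.prod_filter]
  have : ∏ n ∈ (Finset.range N).filter (fun n : ℕ => (n : ℕ∞) < Φ.num ω), (1 - s (Φ.pt n ω)) =
      ∏ n ∈ (Finset.range N).filter (fun n : ℕ => (n : ℕ∞) < Φ.num ω ∧ s (Φ.pt n ω) ≠ 0),
        (1 - s (Φ.pt n ω)) := by
    rw [← Finset.filter_filter]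
    symm
    refine Finset.prod_subset (Finset.filter_subset _ _) fun n hn hn' => ?_
    have : s (Φ.pt n ω) = 0 := by
      by_contra h0
      exact hn' (Finset.mem_filter.2 ⟨hn, h0⟩)
    simp [this]
  rw [this, ← Finset.prod_fiberwise_of_maps_to (t := s.range.erase 0) (g := fun n => s (Φ.pt n ω))]
  · refine Finset.prod_congr rfl fun c hc => ?_
    rw [Finset.prod_congr rfl (g := fun _ => 1 - c), Finset.prod_const]
    · congr 1
      rw [RandomPoints.count, ← Set.ncard_coe_finset, Set.ncard]
      congr 2
      ext n
      simp only [mem_ofPred_eq, mem_preimage, mem_singleton_iff, Finset.coe_filter,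
        Finset.mem_filter, Finset.mem_range]
      constructor
      · intro h
        have : n ≤ N₀ := hN₀ (mem_biUnion hc h)
        refine ⟨⟨by omega, h.1, ?_⟩, h.2⟩
        rw [h.2]; exact Finset.ne_of_mem_erase hc
      · exact fun h => ⟨h.1.2.1, h.2⟩
    · intro n hn
      rw [(Finset.mem_filter.1 hn).2]
  · intro n hn
    simp only [Finset.mem_filter] at hn
    exact Finset.mem_erase.2 ⟨hn.2.2, s.mem_range_self _⟩

/-- Level sets are disjoint, so their counts are independent and the mean of the product factorises;
the exponents of the Poisson factors add up to the integral of `s`. -/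
lemma IsPoissonProcess.lintegral_iInf_partialProd_simpleFunc [IsProbabilityMeasure μ]
    (h : IsPoissonProcess Φ Λ μ)
    (s : SimpleFunc E ℝ≥0∞) (hs : ∀ x, s x ≤ 1) (hfin : ∀ c ≠ 0, Λ (s ⁻¹' {c}) ≠ ⊤) :
    ∫⁻ ω, ⨅ N, Φ.partialProd (fun x => 1 - s x) N ω ∂μ =
      ENNReal.ofReal (Real.exp (-(∫⁻ x, s x ∂Λ).toReal)) := by
  classical
  set R := s.range.erase 0 with hR
  have hR0 : ∀ c ∈ R, c ≠ 0 := fun c hc => Finset.ne_of_mem_erase hc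
  have hR1 : ∀ c ∈ R, c ≤ 1 := fun c hc => by
    obtain ⟨x, rfl⟩ := SimpleFunc.mem_range.1 (Finset.mem_of_mem_erase hc)
    exact hs x
  have hae : ∀ᵐ ω ∂μ, ∀ c ∈ R, Φ.count (s ⁻¹' {c}) ω ≠ ⊤ := by
    rw [Filter.eventually_all_finset]
    exact fun c hc => h.ae_count_ne_top (s.measurableSet_fiber c) (hfin c (hR0 c hc))
  -- Independence of counts is given for families indexed by `Fin k`, so the nonzero values are
  -- enumerated.
  have hind : iIndepFun (fun (c : R) ω => Φ.count (s ⁻¹' {(c : ℝ≥0∞)}) ω) μ := by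
    have h1 := h.indep_count R.card (fun i => s ⁻¹' {(R.equivFin.symm i : ℝ≥0∞)})
      (fun i => s.measurableSet_fiber _) (fun i i' hii' => by
        refine Disjoint.preimage _ (disjoint_singleton.2 fun h' => hii' ?_)
        exact R.equivFin.symm.injective (Subtype.ext h'))
    have h2 := h1.precomp R.equivFin.injective
    simpa [Function.comp_def] using h2
  have hind' := hind.comp (fun c k => (1 - (c : ℝ≥0∞)) ^ k.toNat)
    (fun c => measurable_of_countable _)
  have hprod : ∀ ω, ∏ c ∈ R, (1 - c) ^ (Φ.count (s ⁻¹' {c}) ω).toNat =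
      ∏ c : R, (1 - (c : ℝ≥0∞)) ^ (Φ.count (s ⁻¹' {(c : ℝ≥0∞)}) ω).toNat := fun ω =>
    (Finset.prod_coe_sort R (fun c => (1 - c) ^ (Φ.count (s ⁻¹' {c}) ω).toNat)).symm
  rw [lintegral_congr_ae (hae.mono fun ω hω =>
    (Φ.iInf_partialProd_simpleFunc s hω).trans (hprod ω))]
  have hint := lintegral_prod_eq_prod_lintegral_of_indepFun (μ := μ) Finset.univ
    (fun (c : R) ω => (1 - (c : ℝ≥0∞)) ^ (Φ.count (s ⁻¹' {(c : ℝ≥0∞)}) ω).toNat) hind'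
    (fun c => (measurable_of_countable
      (fun k : ℕ∞ => (1 - (c : ℝ≥0∞)) ^ k.toNat)).comp
      (h.measurable_count (s.measurableSet_fiber _)))
  rw [hint]
  have hterm : ∀ c : R, ∫⁻ ω, (1 - (c : ℝ≥0∞)) ^ (Φ.count (s ⁻¹' {(c : ℝ≥0∞)}) ω).toNat ∂μ =
      ENNReal.ofReal (Real.exp (-((c : ℝ≥0∞) * Λ (s ⁻¹' {(c : ℝ≥0∞)})).toReal)) := fun c =>
    h.lintegral_one_sub_pow_count (s.measurableSet_fiber _) (hfin c (hR0 c c.2)) (hR1 c c.2)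
  simp_rw [hterm]
  rw [Finset.prod_coe_sort R
    (fun c => ENNReal.ofReal (Real.exp (-(c * Λ (s ⁻¹' {c})).toReal))),
    ← ENNReal.ofReal_prod_of_nonneg (fun _ _ => (Real.exp_pos _).le), ← Real.exp_sum,
    Finset.sum_neg_distrib, ← ENNReal.toReal_sum, SimpleFunc.lintegral_eq_lintegral s Λ,
    SimpleFunc.lintegral, hR]
  · congr 4
    by_cases h0 : (0 : ℝ≥0∞) ∈ s.range
    · rw [← Finset.add_sum_erase _ _ h0]; simp
    · rw [Finset.erase_eq_of_notMem h0]
  · exact fun c hc => ENNReal.mul_ne_top (ne_top_of_le_ne_top ENNReal.one_ne_top (hR1 c hc))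
      (hfin c (hR0 c hc))

/-- The probability generating functional of a Poisson process. -/
theorem IsPoissonProcess.lintegral_iInf_partialProd [IsProbabilityMeasure μ] [SigmaFinite Λ]
    (h : IsPoissonProcess Φ Λ μ) {u : E → ℝ≥0∞} (hu : Measurable u) (hu1 : ∀ x, u x ≤ 1)
    (hfin : ∫⁻ x, u x ∂Λ ≠ ⊤) :
    ∫⁻ ω, ⨅ N, Φ.partialProd (fun x => 1 - u x) N ω ∂μ =
      ENNReal.ofReal (Real.exp (-(∫⁻ x, u x ∂Λ).toReal)) := by
  -- Cutting off to a spanning set gives the nonzero level sets finite intensity, and the sequence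
  -- still increases to `u`.
  let s : ℕ → SimpleFunc E ℝ≥0∞ := fun k =>
    (SimpleFunc.eapprox u k).restrict (spanningSets Λ k)
  have hs_apply : ∀ k x, s k x = (spanningSets Λ k).indicator (SimpleFunc.eapprox u k) x :=
    fun k x => by rw [SimpleFunc.restrict_apply _ (measurableSet_spanningSets Λ k)]
  have hmono : Monotone fun k x => s k x := by
    intro k l hkl x
    simp only [hs_apply]
    refine (indicator_le_indicator (SimpleFunc.monotone_eapprox u hkl x)).trans
      (indicator_le_indicator_of_subset (monotone_spanningSets Λ hkl) (fun _ => zero_le) x)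
  have hsup : ∀ x, ⨆ k, s k x = u x := by
    intro x
    refine le_antisymm (iSup_le fun k => ?_) ?_
    · rw [hs_apply]
      refine (indicator_le_self _ _ x).trans ?_
      rw [← SimpleFunc.iSup_eapprox_apply hu x]
      exact le_iSup (fun k => SimpleFunc.eapprox u k x) k
    · rw [← SimpleFunc.iSup_eapprox_apply hu x]
      refine iSup_le fun k => ?_
      set l := max k (spanningSetsIndex Λ x)
      refine le_trans ?_ (le_iSup _ l)
      rw [hs_apply, indicator_of_mem]
      · exact SimpleFunc.monotone_eapprox u (le_max_left _ _) x
      · exact monotone_spanningSets Λ (le_max_right _ _) (mem_spanningSetsIndex Λ x)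
  have hle : ∀ k x, s k x ≤ u x := fun k x => (hsup x) ▸ le_iSup (fun k => s k x) k
  have hsimple : ∀ k, ∫⁻ ω, ⨅ N, Φ.partialProd (fun x => 1 - s k x) N ω ∂μ =
      ENNReal.ofReal (Real.exp (-(∫⁻ x, s k x ∂Λ).toReal)) := fun k => by
    refine h.lintegral_iInf_partialProd_simpleFunc (s k) (fun x => (hle k x).trans (hu1 x)) ?_
    intro c hc
    refine ne_top_of_le_ne_top (measure_spanningSets_lt_top Λ k).ne (measure_mono fun x hx => ?_)
    by_contra hx'
    apply hc
    rw [← show s k x = c from hx, hs_apply, indicator_of_notMem hx']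
  have hanti : ∀ N ω, Antitone fun k => Φ.partialProd (fun x => 1 - s k x) N ω :=
    fun N ω k l hkl => Φ.partialProd_mono (fun x => tsub_le_tsub_left (hmono hkl x) 1) N ω
  have hinf : ∀ N ω, ⨅ k, Φ.partialProd (fun x => 1 - s k x) N ω =
      Φ.partialProd (fun x => 1 - u x) N ω := by
    intro N ω
    refine tendsto_nhds_unique (tendsto_atTop_iInf (hanti N ω)) ?_
    refine ENNReal.tendsto_finsetProd_of_ne_top _ (fun n _ => ?_) (fun n _ => ?_)
    · split_ifs
      · beta_reduce
        rw [← hsup, ENNReal.sub_iSup ENNReal.one_ne_top]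
        exact tendsto_atTop_iInf fun k l hkl => tsub_le_tsub_left (hmono hkl _) 1
      · exact tendsto_const_nhds
    · split_ifs
      · exact ne_top_of_le_ne_top ENNReal.one_ne_top tsub_le_self
      · exact ENNReal.one_ne_top
  -- The infima over `k` and `N` commute, and decreasing monotone convergence applies because
  -- everything is bounded by the empty product 1.
  have hL : ∫⁻ ω, ⨅ N, Φ.partialProd (fun x => 1 - u x) N ω ∂μ =
      ⨅ k, ∫⁻ ω, ⨅ N, Φ.partialProd (fun x => 1 - s k x) N ω ∂μ := by
    rw [← lintegral_iInf]
    · refine lintegral_congr fun ω => ?_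
      rw [iInf_comm]
      simp_rw [hinf]
    · exact fun k => Measurable.iInf fun N =>
        h.measurable_partialProd (measurable_const.sub (s k).measurable) N
    · exact fun k l hkl ω => iInf_mono fun N => hanti N ω hkl
    · refine ne_top_of_le_ne_top ENNReal.one_ne_top ?_
      refine (lintegral_mono (g := fun _ => 1) fun ω => ?_).trans (by simp)
      exact iInf_le_of_le 0 (by simp [RandomPoints.partialProd])
  rw [hL]
  refine tendsto_nhds_unique (tendsto_atTop_iInf ?_) ?_
  · exact fun k l hkl => lintegral_mono fun ω => iInf_mono fun N => hanti N ω hkl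
  · simp_rw [hsimple]
    refine (ENNReal.continuous_ofReal.comp
      (Real.continuous_exp.comp continuous_neg)).continuousAt.tendsto.comp ?_
    refine (ENNReal.tendsto_toReal hfin).comp ?_
    have : ∫⁻ x, u x ∂Λ = ⨆ k, ∫⁻ x, s k x ∂Λ := by
      rw [← lintegral_iSup (fun k => (s k).measurable) hmono]
      simp_rw [hsup]
    rw [this]
    exact tendsto_atTop_iSup fun k l hkl => lintegral_mono (hmono hkl)

/-! ### Independent marks: void probabilities and local finiteness. -/

variable {χ : ℕ → Ω → ℝ} {ν : Measure ℝ}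

/-- Fubini, by independence of points and marks: with the points frozen, the marks are still
independent, and a point `x` avoids `T` with probability `1 - ν (T_x)`. -/
lemma IsIndepMarking.measure_void_lt [IsProbabilityMeasure μ] (hP : IsPoissonProcess Φ Λ μ)
    (hM : IsIndepMarking Φ χ ν μ) [IsProbabilityMeasure ν] {T : Set (E × ℝ)} (hT : MeasurableSet T)
    (N : ℕ) :
    μ {ω | ∀ n < N, (n : ℕ∞) < Φ.num ω → (Φ.pt n ω, χ n ω) ∉ T} =
      ∫⁻ ω, Φ.partialProd (fun x => 1 - ν (Prod.mk x ⁻¹' T)) N ω ∂μ := by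
  set X : Ω → ℕ∞ × (ℕ → E) := fun ω => (Φ.num ω, fun n => Φ.pt n ω) with hX
  set Y : Ω → ℕ → ℝ := fun ω n => χ n ω with hY
  have hXm : Measurable X := hP.measurable_num.prodMk (measurable_pi_lambda _ hP.measurable_pt)
  have hYm : Measurable Y := measurable_pi_lambda _ hM.measurable_mark
  let S : Set ((ℕ∞ × (ℕ → E)) × (ℕ → ℝ)) :=
    {z | ∀ n < N, (n : ℕ∞) < z.1.1 → (z.1.2 n, z.2 n) ∉ T}
  have hS : MeasurableSet S := by
    have : S = ⋂ n, ⋂ (_ : n < N), ({z | (n : ℕ∞) < z.1.1}ᶜ ∪ {z | (z.1.2 n, z.2 n) ∈ T}ᶜ) := by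
      ext z
      simp only [S, mem_ofPred_eq, mem_iInter, mem_union, mem_compl_iff, imp_iff_not_or]
    rw [this]
    refine MeasurableSet.iInter fun n => MeasurableSet.iInter fun _ =>
      (MeasurableSet.compl ?_).union (MeasurableSet.compl ?_)
    · exact (measurable_fst.comp measurable_fst) (MeasurableSet.of_discrete (s := Ioi (n : ℕ∞)))
    · exact (Measurable.prodMk ((measurable_pi_apply n).comp (measurable_snd.comp measurable_fst))
        ((measurable_pi_apply n).comp measurable_snd)) hT
  have h1 : μ {ω | ∀ n < N, (n : ℕ∞) < Φ.num ω → (Φ.pt n ω, χ n ω) ∉ T} =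
      (μ.map (fun ω => (X ω, Y ω))) S := by
    rw [Measure.map_apply (hXm.prodMk hYm) hS]; rfl
  have : IsProbabilityMeasure (μ.map Y) := Measure.isProbabilityMeasure_map hYm.aemeasurable
  rw [h1, (indepFun_iff_map_prod_eq_prod_map_map hXm.aemeasurable hYm.aemeasurable).1
    hM.indep_points, Measure.prod_apply hS, lintegral_map (measurable_measure_prodMk_left hS) hXm]
  refine lintegral_congr fun ω => ?_
  rw [Measure.map_apply hYm (measurable_prodMk_left hS)]
  have hTx : ∀ x, MeasurableSet (Prod.mk x ⁻¹' T) := fun x => measurable_prodMk_left hT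
  classical
  -- Indices beyond the number of points impose no condition on their marks.
  let C : ℕ → Set ℝ := fun n =>
    if (n : ℕ∞) < Φ.num ω then (Prod.mk (Φ.pt n ω) ⁻¹' T)ᶜ else univ
  have hC : ∀ n, MeasurableSet (C n) := fun n => by
    simp only [C]
    split_ifs
    · exact (hTx _).compl
    · exact .univ
  have h2 : Y ⁻¹' (Prod.mk (X ω) ⁻¹' S) = ⋂ n ∈ Finset.range N, χ n ⁻¹' C n := by
    ext ω'
    simp only [S, mem_preimage, mem_ofPred_eq, mem_iInter, Finset.mem_range, C, hX, hY]
    refine forall₂_congr fun n _ => ?_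
    split_ifs with hn <;> simp [hn]
  rw [h2, hM.iIndep_mark.measure_inter_preimage_eq_mul _ (fun n _ => hC n)]
  refine Finset.prod_congr rfl fun n _ => ?_
  rw [← Measure.map_apply (hM.measurable_mark n) (hC n), hM.map_mark n]
  simp only [C]
  split_ifs
  · exact prob_compl_eq_one_sub (hTx _)
  · exact measure_univ

lemma measurableSet_point_mem (hP : IsPoissonProcess Φ Λ μ)
    (hM : IsIndepMarking Φ χ ν μ) {T : Set (E × ℝ)} (hT : MeasurableSet T) (n : ℕ) :
    MeasurableSet {ω | (n : ℕ∞) < Φ.num ω ∧ (Φ.pt n ω, χ n ω) ∈ T} :=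
  (measurableSet_lt_num hP.measurable_num n).inter
    (((hP.measurable_pt n).prodMk (hM.measurable_mark n)) hT)

lemma IsIndepMarking.measurableSet_void (hP : IsPoissonProcess Φ Λ μ)
    (hM : IsIndepMarking Φ χ ν μ) {T : Set (E × ℝ)} (hT : MeasurableSet T) :
    MeasurableSet (Φ.voidEvent χ T) := by
  have : Φ.voidEvent χ T = ⋂ n : ℕ, {ω | (n : ℕ∞) < Φ.num ω ∧ (Φ.pt n ω, χ n ω) ∈ T}ᶜ := by
    ext ω
    simp [RandomPoints.voidEvent]
  rw [this]
  exact .iInter fun n => (measurableSet_point_mem hP hM hT n).compl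

/-- Void probabilities of an independently marked Poisson process. -/
theorem IsIndepMarking.measure_void [IsProbabilityMeasure μ] [SigmaFinite Λ]
    (hP : IsPoissonProcess Φ Λ μ)
    (hM : IsIndepMarking Φ χ ν μ) [IsProbabilityMeasure ν] {T : Set (E × ℝ)} (hT : MeasurableSet T)
    (hfin : (Λ.prod ν) T ≠ ⊤) :
    μ (Φ.voidEvent χ T) = ENNReal.ofReal (Real.exp (-((Λ.prod ν) T).toReal)) := by
  have hu : Measurable fun x => ν (Prod.mk x ⁻¹' T) := measurable_measure_prodMk_left hT
  rw [Measure.prod_apply hT] at hfin ⊢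
  rw [← hP.lintegral_iInf_partialProd hu (fun _ => prob_le_one) hfin, lintegral_iInf,
    Φ.voidEvent_eq_iInter]
  · have hanti : Antitone fun N : ℕ =>
        {ω | ∀ n < N, (n : ℕ∞) < Φ.num ω → (Φ.pt n ω, χ n ω) ∉ T} :=
      fun N N' hN ω hω n hn => hω n (hn.trans_le hN)
    rw [hanti.measure_iInter]
    · simp_rw [hM.measure_void_lt hP hT]
    · intro N
      have : {ω | ∀ n < N, (n : ℕ∞) < Φ.num ω → (Φ.pt n ω, χ n ω) ∉ T} =
          ⋂ n, ⋂ (_ : n < N), {ω | (n : ℕ∞) < Φ.num ω ∧ (Φ.pt n ω, χ n ω) ∈ T}ᶜ := by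
        ext ω; simp
      rw [this]
      exact (MeasurableSet.iInter fun n => .iInter fun _ =>
        (measurableSet_point_mem hP hM hT n).compl).nullMeasurableSet
    · exact ⟨0, measure_ne_top _ _⟩
  · exact fun N => hP.measurable_partialProd (measurable_const.sub hu) N
  · exact fun N N' hN ω => Φ.antitone_partialProd (fun _ => tsub_le_self) ω hN
  · refine ne_top_of_le_ne_top ENNReal.one_ne_top ?_
    refine (lintegral_mono (g := fun _ => 1) fun ω => ?_).trans (by simp)
    exact Φ.partialProd_le_one (fun _ => tsub_le_self) 0 ω

/-- An independently marked Poisson process has a.s. finitely many points in a set of finite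
intensity. -/
theorem IsIndepMarking.ae_finite [IsProbabilityMeasure μ] [SigmaFinite Λ]
    (hP : IsPoissonProcess Φ Λ μ)
    (hM : IsIndepMarking Φ χ ν μ) [IsProbabilityMeasure ν] {T : Set (E × ℝ)} (hT : MeasurableSet T)
    (hfin : (Λ.prod ν) T ≠ ⊤) :
    ∀ᵐ ω ∂μ, {n : ℕ | (n : ℕ∞) < Φ.num ω ∧ (Φ.pt n ω, χ n ω) ∈ T}.Finite := by
  have hm : ∀ k, MeasurableSet ((spanningSets Λ k)ᶜ ×ˢ (univ : Set ℝ)) := fun k =>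
    (measurableSet_spanningSets Λ k).compl.prod .univ
  -- These parts of `T` decrease to the empty set with finite measure, so their void probabilities
  -- tend to 1. Almost surely some `A k` is void, and then all points in `T` lie over a spanning
  -- set, which contains finitely many points.
  let A : ℕ → Set (E × ℝ) := fun k => T ∩ (spanningSets Λ k)ᶜ ×ˢ univ
  have hA : ∀ k, MeasurableSet (A k) := fun k => hT.inter (hm k)
  have hAanti : Antitone A := fun k l hkl =>
    inter_subset_inter_right _ (prod_mono_left (compl_subset_compl.2 (monotone_spanningSets Λ hkl)))
  have hAfin : ∀ k, (Λ.prod ν) (A k) ≠ ⊤ := fun k =>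
    ne_top_of_le_ne_top hfin (measure_mono inter_subset_left)
  have hA0 : Tendsto (fun k => (Λ.prod ν) (A k)) atTop (𝓝 0) := by
    have h1 := tendsto_measure_iInter_atTop (μ := Λ.prod ν) (fun k => (hA k).nullMeasurableSet)
      hAanti ⟨0, hAfin 0⟩
    have h2 : ⋂ k, A k = ∅ := by
      refine eq_empty_of_forall_notMem fun z hz => ?_
      exact (mem_iInter.1 hz (spanningSetsIndex Λ z.1)).2.1 (mem_spanningSetsIndex Λ z.1)
    simpa [h2, Function.comp_def] using h1
  have hU : μ (⋃ k, Φ.voidEvent χ (A k)) = 1 := by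
    have h1 : Tendsto (fun k => μ (Φ.voidEvent χ (A k))) atTop (𝓝 1) := by
      simp_rw [fun k => hM.measure_void hP (hA k) (hAfin k)]
      have := (ENNReal.continuous_ofReal.comp
        (Real.continuous_exp.comp continuous_neg)).continuousAt.tendsto.comp
        ((ENNReal.tendsto_toReal ENNReal.zero_ne_top).comp hA0)
      simpa [Function.comp_def] using this
    refine le_antisymm prob_le_one (le_of_tendsto' h1 fun k => measure_mono
      (subset_iUnion (fun k => Φ.voidEvent χ (A k)) k))
  have hae : ∀ᵐ ω ∂μ, ∃ k, ω ∈ Φ.voidEvent χ (A k) := by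
    have hmeas : MeasurableSet (⋃ k, Φ.voidEvent χ (A k)) :=
      .iUnion fun k => hM.measurableSet_void hP (hA k)
    filter_upwards [(prob_compl_eq_zero_iff hmeas).2 hU |> compl_mem_ae_iff.2] with ω hω
    simpa using hω
  have hcount : ∀ᵐ ω ∂μ, ∀ k, Φ.count (spanningSets Λ k) ω ≠ ⊤ := ae_all_iff.2 fun k =>
    hP.ae_count_ne_top (measurableSet_spanningSets Λ k) (measure_spanningSets_lt_top Λ k).ne
  filter_upwards [hae, hcount] with ω ⟨k, hk⟩ hc
  have := hc k
  rw [RandomPoints.count, Ne, encard_eq_top_iff, not_infinite] at this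
  refine this.subset fun n hn => ⟨hn.1, ?_⟩
  by_contra hn'
  exact hk n hn.1 ⟨hn.2, hn', mem_univ _⟩

end Poisson

/-! ### The Gaussian tail -/

lemma gaussianPDFReal_std (x : ℝ) :
    gaussianPDFReal 0 1 x = (√(2 * Real.pi))⁻¹ * Real.exp (-x ^ 2 / 2) := by
  simp [gaussianPDFReal]

lemma continuous_gaussianPDFReal_std : Continuous (gaussianPDFReal 0 1) := by
  have : gaussianPDFReal 0 1 = fun x => (√(2 * Real.pi))⁻¹ * Real.exp (-x ^ 2 / 2) :=
    funext gaussianPDFReal_std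
  rw [this]
  fun_prop

lemma Q_eq_integral (x : ℝ) : Q x = ∫ y in Ioi x, gaussianPDFReal 0 1 y := by
  rw [Q, Measure.real, gaussianReal_apply_eq_integral 0 one_ne_zero, ENNReal.toReal_ofReal]
  exact integral_nonneg fun y => gaussianPDFReal_nonneg 0 1 y

lemma hasDerivAt_Q (x : ℝ) : HasDerivAt Q (-gaussianPDFReal 0 1 x) x := by
  have hint : Integrable (gaussianPDFReal 0 1) := integrable_gaussianPDFReal 0 1
  have hQ : Q = fun x => Q 0 - ∫ y in (0 : ℝ)..x, gaussianPDFReal 0 1 y := by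
    funext x
    rw [Q_eq_integral, Q_eq_integral,
      ← intervalIntegral.integral_Ioi_sub_Ioi' hint.integrableOn hint.integrableOn]
    ring
  rw [hQ]
  exact (intervalIntegral.integral_hasDerivAt_right (hint.intervalIntegrable)
    continuous_gaussianPDFReal_std.stronglyMeasurable.stronglyMeasurableAtFilter
    continuous_gaussianPDFReal_std.continuousAt).const_sub _

/-- Exponential tilting by `a` turns the standard Gaussian density into `exp (a ^ 2 / 2)` times that
of mean `a`; the reflection `z ↦ a - z` then turns the lower tail into a value of `Q`. -/
lemma setIntegral_exp_mul_gaussianReal (a u : ℝ) :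
    ∫ z in Iio u, Real.exp (a * z) ∂(gaussianReal 0 1) =
      Real.exp (a ^ 2 / 2) * Q (a - u) := by
  have h1 : (gaussianReal a 1).real (Iio u) = Q (a - u) := by
    have h := gaussianReal_map_const_sub (μ := 0) (v := 1) a
    rw [sub_zero] at h
    rw [← h, Q, Measure.real, Measure.real, Measure.map_apply (by fun_prop) measurableSet_Iio]
    congr 2
    ext z
    simp only [mem_preimage, mem_Iio, mem_Ioi]
    constructor <;> intro h <;> linarith
  rw [← h1, Measure.real, gaussianReal_apply_eq_integral a one_ne_zero, ENNReal.toReal_ofReal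
    (integral_nonneg fun y => gaussianPDFReal_nonneg a 1 y), ← integral_const_mul,
    ← integral_indicator measurableSet_Iio, integral_gaussianReal_eq_integral_smul one_ne_zero,
    ← integral_indicator measurableSet_Iio]
  refine integral_congr_ae (ae_of_all _ fun z => ?_)
  by_cases hz : z ∈ Iio u
  · simp only [indicator_of_mem hz, gaussianPDFReal, smul_eq_mul, NNReal.coe_one, mul_one]
    rw [mul_left_comm, mul_assoc, ← Real.exp_add, ← Real.exp_add]
    ring_nf
  · simp only [indicator_of_notMem hz, smul_zero]

lemma integral_exp_mul_gaussianReal (a : ℝ) :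
    ∫ z, Real.exp (a * z) ∂(gaussianReal 0 1) = Real.exp (a ^ 2 / 2) := by
  have := mgf_fun_id_gaussianReal (μ := 0) (v := 1)
  simpa [mgf] using congrFun this a

/-! ### The derivatives of the explicit functions -/

section Params

variable {P : Params} {j : LinkType}

lemma sigma_pos (hxi : 0 < P.xi j) : 0 < sigma P j := by
  have := Real.log_pos (show (1 : ℝ) < 10 by norm_num)
  unfold sigma
  positivity

lemma hasDerivAt_Upsilon (hD : 0 < P.D) {t : ℝ} (ht : 0 < t) :
    HasDerivAt (Upsilon P j) (-(1 / (t * sigma P j))) t := by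
  have hDa : P.D ^ P.alpha j ≠ 0 := (Real.rpow_pos_of_pos hD _).ne'
  have h : HasDerivAt (fun t => ((Real.log (P.D ^ P.alpha j) - Real.log t) - m P) / sigma P j)
      ((-t⁻¹) / sigma P j) t :=
    (((Real.hasDerivAt_log ht.ne').const_sub _).sub_const _).div_const _
  refine (h.congr_of_eventuallyEq ?_).congr_deriv ?_
  · filter_upwards [lt_mem_nhds ht] with s hs
    rw [Upsilon, Real.log_div hDa hs.ne']
  · rw [neg_div, inv_eq_one_div, div_div]

lemma hasDerivAt_Q_Upsilon (hD : 0 < P.D) {t : ℝ} (ht : 0 < t) :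
    HasDerivAt (fun t => Q (Upsilon P j t))
      (gaussianPDFReal 0 1 (Upsilon P j t) / (t * sigma P j)) t := by
  refine ((hasDerivAt_Q _).comp t (hasDerivAt_Upsilon hD ht)).congr_deriv ?_
  ring

/-- Identifies the explicit Gaussian factor as the one produced by differentiating `qShift`. -/
lemma gaussTerm_eq (hs : 0 < sigma P j) (t : ℝ) :
    gaussTerm P j t = gaussianPDFReal 0 1
      (2 * sigma P j ^ 2 / (P.alpha j * sigma P j) - Upsilon P j t) / sigma P j := by
  have h2 : √2 ≠ 0 := by positivity
  have h22 : √2 * √2 = (2 : ℝ) := Real.mul_self_sqrt (by norm_num)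
  have he : √2 * sigma P j / P.alpha j - Upsilon P j t / √2 =
      (2 * sigma P j ^ 2 / (P.alpha j * sigma P j) - Upsilon P j t) / √2 := by
    rw [sub_div]
    congr 1
    rw [eq_div_iff h2, pow_two, ← mul_assoc, mul_div_mul_right _ _ hs.ne']
    linear_combination (sigma P j / P.alpha j) * h22
  rw [gaussTerm, he, gaussianPDFReal_std, Real.sqrt_mul (by positivity), Real.sqrt_sq hs.le, div_pow,
    Real.sq_sqrt (by norm_num : (0 : ℝ) ≤ 2), neg_div]
  field_simp

lemma edgeTerm_eq (t : ℝ) :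
    edgeTerm P j t = P.D ^ 2 * (gaussianPDFReal 0 1 (Upsilon P j t) / (t * sigma P j)) := by
  rw [edgeTerm, gaussianPDFReal_std]
  simp only [div_eq_mul_inv, mul_inv]
  ring

lemma hasDerivAt_qShift (hD : 0 < P.D) (hs : 0 < sigma P j) {t : ℝ} (ht : 0 < t) :
    HasDerivAt (qShift P j) (-(gaussTerm P j t / t)) t := by
  refine ((hasDerivAt_Q _).comp t ((hasDerivAt_Upsilon hD ht).const_sub _)).congr_deriv ?_
  rw [gaussTerm_eq hs]
  have := hs.ne'
  field_simp

theorem hasDerivAt_M (hp : 0 < P.p) (hD : 0 < P.D) (halpha : ∀ j, 0 < P.alpha j)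
    (hxi : ∀ j, 0 < P.xi j) (j : LinkType) {t : ℝ} (ht : 0 < t) :
    HasDerivAt (M P j) (M' P j t) t := by
  -- The spare factor `t` absorbs the `1 / t` in the derivative of `qShift`.
  have hpow : t ^ (2 / P.alpha j) = t ^ (2 / P.alpha j - 1) * t := by
    rw [Real.rpow_sub_one ht.ne', div_mul_cancel₀ _ ht.ne']
  have hpow' := Real.hasDerivAt_rpow_const (x := t) (p := 2 / P.alpha j) (Or.inl ht.ne')
  have hQ := hasDerivAt_Q_Upsilon (P := P) (j := j) hD ht
  have hS := hasDerivAt_qShift hD (sigma_pos (hxi j)) ht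
  have ha := (halpha j).ne'
  cases j with
  | LOS =>
    refine (((hQ.const_mul (P.D ^ 2)).add ((hpow'.mul_const (expConst P .LOS)).mul hS)).const_mul
      (Real.pi * P.p)).congr_deriv ?_
    rw [M', edgeTerm_eq, hpow]
    field_simp
    ring
  | NLOS =>
    refine ((hQ.const_mul (Real.pi * P.p * P.D ^ 2)).neg.add
      (((hpow'.const_mul Real.pi).mul_const (expConst P .NLOS)).mul
        ((hS.const_mul P.p).const_sub 1))).congr_deriv ?_
    rw [M', edgeTerm_eq, hpow]
    field_simp
    ring

/-! ### The intensity of the propagation process -/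

lemma measurable_density : Measurable (density P j) := by
  have : MeasurableSet {x : Plane | ‖x‖ ≤ P.D} := measurableSet_le measurable_norm measurable_const
  cases j
  · exact Measurable.ite this measurable_const measurable_const
  · exact Measurable.ite this measurable_const measurable_const

/-- Mean number of base stations of type `j` in a disk of squared radius `q`, divided by `λ`. -/
noncomputable def diskMean (P : Params) : LinkType → ℝ → ℝ
  | .LOS, q => Real.pi * P.p * min q (P.D ^ 2)
  | .NLOS, q => Real.pi * q - Real.pi * P.p * min q (P.D ^ 2)

lemma diskMean_nonneg (hp : 0 < P.p) (hp1 : P.p ≤ 1) (j : LinkType) {q : ℝ} (hq : 0 ≤ q) :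
    0 ≤ diskMean P j q := by
  have hm : 0 ≤ min q (P.D ^ 2) := le_min hq (sq_nonneg _)
  cases j with
  | LOS => exact mul_nonneg (by positivity) hm
  | NLOS =>
    have h1 : P.p * min q (P.D ^ 2) ≤ 1 * q := mul_le_mul hp1 (min_le_left _ _) hm zero_le_one
    have h2 := mul_le_mul_of_nonneg_left h1 Real.pi_pos.le
    rw [diskMean]
    linarith

/-- The LOS intensity is uniform on the disk of radius `D`. The two densities add up to the constant
`λ`, so the NLOS case follows by subtraction. -/
lemma intensity_closedBall (hlam : 0 < P.lam) (hp : 0 < P.p) (hp1 : P.p ≤ 1) (hD : 0 < P.D)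
    (j : LinkType) {r : ℝ} (hr : 0 ≤ r) :
    intensity P j (Metric.closedBall 0 r) = ENNReal.ofReal (P.lam * diskMean P j (r ^ 2)) := by
  have hball : ∀ s : ℝ, 0 ≤ s → volume (Metric.closedBall (0 : Plane) s) =
      ENNReal.ofReal (Real.pi * s ^ 2) := fun s hs => by
    rw [EuclideanSpace.volume_closedBall_fin_two, ← ENNReal.ofReal_pow hs,
      ← ENNReal.ofReal_mul (by positivity), mul_comm]
  have hL : intensity P .LOS (Metric.closedBall 0 r) =
      ENNReal.ofReal (P.lam * (Real.pi * P.p * min (r ^ 2) (P.D ^ 2))) := by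
    have h1 : ∀ x : Plane, ENNReal.ofReal (density P .LOS x) =
        (Metric.closedBall 0 P.D).indicator (fun _ => ENNReal.ofReal (P.lam * P.p)) x := fun x => by
      by_cases hx : ‖x‖ ≤ P.D
      · rw [indicator_of_mem (by simpa using hx)]; simp [density, hx]
      · rw [indicator_of_notMem (by simpa using hx)]; simp [density, hx]
    have h2 : (min r P.D) ^ 2 = min (r ^ 2) (P.D ^ 2) := by
      rcases le_total r P.D with h | h
      · rw [min_eq_left h, min_eq_left (pow_le_pow_left₀ hr h 2)]
      · rw [min_eq_right h, min_eq_right (pow_le_pow_left₀ hD.le h 2)]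
    have h3 : Metric.closedBall (0 : Plane) P.D ∩ Metric.closedBall 0 r =
        Metric.closedBall 0 (min r P.D) := by
      ext x; simp [and_comm]
    rw [intensity, withDensity_apply _ Metric.isClosed_closedBall.measurableSet]
    simp_rw [h1]
    rw [lintegral_indicator Metric.isClosed_closedBall.measurableSet, setLIntegral_const,
      Measure.restrict_apply Metric.isClosed_closedBall.measurableSet, h3,
      hball _ (le_min hr hD.le), ← ENNReal.ofReal_mul (by positivity), h2]
    congr 1
    ring
  cases j with
  | LOS => exact hL
  | NLOS =>
    have hsum : intensity P .NLOS (Metric.closedBall 0 r) + intensity P .LOS (Metric.closedBall 0 r)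
        = ENNReal.ofReal (P.lam * (Real.pi * r ^ 2)) := by
      simp only [intensity]
      rw [withDensity_apply _ Metric.isClosed_closedBall.measurableSet,
        withDensity_apply _ Metric.isClosed_closedBall.measurableSet,
        ← lintegral_add_left measurable_density.ennreal_ofReal, ENNReal.ofReal_mul hlam.le,
        ← hball r hr, ← setLIntegral_const]
      refine lintegral_congr fun x => ?_
      simp only [density]
      have h1p : 0 ≤ P.lam * (1 - P.p) := mul_nonneg hlam.le (by linarith)
      split_ifs
      · rw [← ENNReal.ofReal_add h1p (by positivity)]
        congr 1; ring
      · simp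
    rw [hL] at hsum
    rw [ENNReal.eq_sub_of_add_eq ENNReal.ofReal_ne_top hsum,
      ← ENNReal.ofReal_sub _ (by positivity)]
    congr 1
    rw [diskMean]
    ring

/-! ### Sublevel sets of the loss and their lognormal radii. -/

lemma gain_pos (s : ℝ) : 0 < gain P s := Real.rpow_pos_of_pos (by norm_num) _

/-- The shadowing is written as `-ξ z` with `z` standard Gaussian; by symmetry the sign does not
change its law, and it makes the gain increase with `z`. -/
lemma gain_neg_mul (j : LinkType) (z : ℝ) :
    gain P (-P.xi j * z) = Real.exp (m P + sigma P j * z) := by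
  rw [gain, Real.rpow_def_of_pos (by norm_num), m, sigma]
  congr 1
  ring

lemma loss_nonneg (x : Plane) (s : ℝ) : 0 ≤ loss P j x s :=
  div_nonneg (Real.rpow_nonneg (norm_nonneg _) _) (gain_pos s).le

lemma measurable_loss : Measurable fun z : Plane × ℝ => loss P j z.1 z.2 := by
  unfold loss gain
  fun_prop

lemma setOf_loss_le (ha : 0 < P.alpha j) {t : ℝ} (ht : 0 < t) (s : ℝ) :
    {x : Plane | loss P j x s ≤ t} =
      Metric.closedBall 0 ((t * gain P s) ^ (1 / P.alpha j)) := by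
  ext x
  have h0 : 0 ≤ t * gain P s := (mul_pos ht (gain_pos s)).le
  rw [mem_ofPred_eq, mem_closedBall_zero_iff, loss, div_le_iff₀ (gain_pos s), one_div,
    Real.le_rpow_inv_iff_of_pos (norm_nonneg x) h0 ha]

/-- Square of the distance within which the loss is at most `t` when the standardized shadowing
gain is `z`. -/
noncomputable def sqRadius (P : Params) (j : LinkType) (t z : ℝ) : ℝ :=
  t ^ (2 / P.alpha j) * Real.exp (2 * m P / P.alpha j) *
    Real.exp (2 * sigma P j / P.alpha j * z)

lemma sqRadius_eq {t : ℝ} (ht : 0 < t) (z : ℝ) :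
    ((t * gain P (-P.xi j * z)) ^ (1 / P.alpha j)) ^ 2 = sqRadius P j t z := by
  have h0 : 0 ≤ t * gain P (-P.xi j * z) := (mul_pos ht (gain_pos _)).le
  rw [← Real.rpow_natCast, ← Real.rpow_mul h0, gain_neg_mul, sqRadius,
    Real.mul_rpow ht.le (Real.exp_pos _).le, ← Real.exp_mul, mul_assoc, ← Real.exp_add]
  have : 1 / P.alpha j * ((2 : ℕ) : ℝ) = 2 / P.alpha j := by push_cast; ring
  rw [this]
  congr 2
  ring

/-- This is the meaning of `Upsilon`: the standardized gain at which the disk of loss at most `t`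
reaches radius `D`. -/
lemma sqRadius_lt_iff (hD : 0 < P.D) (ha : 0 < P.alpha j) (hs : 0 < sigma P j) {t : ℝ} (ht : 0 < t)
    (z : ℝ) : sqRadius P j t z < P.D ^ 2 ↔ z < Upsilon P j t := by
  have hDa : 0 < P.D ^ P.alpha j := Real.rpow_pos_of_pos hD _
  have h1 : sqRadius P j t z =
      Real.exp (2 / P.alpha j * (Real.log t + m P + sigma P j * z)) := by
    rw [sqRadius, Real.rpow_def_of_pos ht, ← Real.exp_add, ← Real.exp_add]
    congr 1; ring
  have h2 : P.D ^ 2 = Real.exp (2 / P.alpha j * (P.alpha j * Real.log P.D)) := by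
    rw [← mul_assoc, div_mul_cancel₀ _ ha.ne', mul_comm, Real.exp_mul, Real.exp_log hD]
    norm_cast
  rw [h1, h2, Real.exp_lt_exp, mul_lt_mul_iff_right₀ (by positivity), Upsilon, lt_div_iff₀ hs,
    Real.log_div hDa.ne' ht.ne', Real.log_rpow hD]
  constructor <;> intro h <;> linarith

lemma integrable_sqRadius (t : ℝ) : Integrable (sqRadius P j t) (gaussianReal 0 1) :=
  (integrable_exp_mul_gaussianReal _).const_mul _

lemma expConst_eq (P : Params) (j : LinkType) :
    expConst P j = Real.exp (2 * m P / P.alpha j) *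
      Real.exp ((2 * sigma P j / P.alpha j) ^ 2 / 2) := by
  rw [expConst, ← Real.exp_add]
  congr 1; ring

lemma integral_sqRadius (t : ℝ) :
    ∫ z, sqRadius P j t z ∂(gaussianReal 0 1) = t ^ (2 / P.alpha j) * expConst P j := by
  simp only [sqRadius]
  rw [integral_const_mul, integral_exp_mul_gaussianReal, expConst_eq, mul_assoc]

lemma sqRadius_nonneg {t : ℝ} (ht : 0 < t) (z : ℝ) : 0 ≤ sqRadius P j t z := by
  unfold sqRadius; positivity

lemma continuous_sqRadius (t : ℝ) : Continuous (sqRadius P j t) := by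
  unfold sqRadius; fun_prop

lemma integrable_min_sqRadius {t : ℝ} (ht : 0 < t) :
    Integrable (fun z => min (sqRadius P j t z) (P.D ^ 2)) (gaussianReal 0 1) := by
  refine (integrable_sqRadius (P := P) (j := j) t).mono'
    ((continuous_sqRadius t).min continuous_const).aestronglyMeasurable (ae_of_all _ fun z => ?_)
  rw [Real.norm_of_nonneg (le_min (sqRadius_nonneg ht z) (sq_nonneg _))]
  exact min_le_left _ _

/-- Below `Upsilon` the minimum is the squared radius, whose truncated exponential moment gives
`qShift`; above it the minimum is `D ^ 2`, with mass `Q (Upsilon)`. -/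
lemma integral_min_sqRadius (hD : 0 < P.D) (ha : 0 < P.alpha j) (hs : 0 < sigma P j) {t : ℝ}
    (ht : 0 < t) :
    ∫ z, min (sqRadius P j t z) (P.D ^ 2) ∂(gaussianReal 0 1) =
      P.D ^ 2 * Q (Upsilon P j t) + t ^ (2 / P.alpha j) * expConst P j * qShift P j t := by
  rw [← integral_add_compl measurableSet_Iio (s := Iio (Upsilon P j t))
    (integrable_min_sqRadius ht), compl_Iio]
  have h1 : ∫ z in Iio (Upsilon P j t), min (sqRadius P j t z) (P.D ^ 2) ∂(gaussianReal 0 1) =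
      t ^ (2 / P.alpha j) * expConst P j * qShift P j t := by
    rw [setIntegral_congr_fun measurableSet_Iio (g := sqRadius P j t) fun z hz =>
      min_eq_left ((sqRadius_lt_iff hD ha hs ht z).2 hz).le]
    simp only [sqRadius]
    rw [integral_const_mul, setIntegral_exp_mul_gaussianReal, qShift, expConst_eq, pow_two (sigma P j),
      ← mul_assoc 2, mul_div_mul_right _ _ hs.ne']
    ring
  have h2 : ∫ z in Ici (Upsilon P j t), min (sqRadius P j t z) (P.D ^ 2) ∂(gaussianReal 0 1) =
      P.D ^ 2 * Q (Upsilon P j t) := by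
    have : NullSingletonClass (gaussianReal 0 1) := nullSingletonClass_gaussianReal one_ne_zero
    rw [setIntegral_congr_fun measurableSet_Ici (g := fun _ => P.D ^ 2) fun z hz =>
      min_eq_right (not_lt.1 fun h => not_lt.2 hz ((sqRadius_lt_iff hD ha hs ht z).1 h)),
      setIntegral_const, smul_eq_mul, mul_comm, Q, measureReal_congr Ioi_ae_eq_Ici]
  rw [h1, h2, add_comm]

lemma gaussianReal_shadowing (j : LinkType) :
    gaussianReal 0 (P.xi j ^ 2).toNNReal = (gaussianReal 0 1).map (fun z => -P.xi j * z) := by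
  rw [gaussianReal_map_const_mul]
  congr 1
  · simp
  · ext
    simp [Real.coe_toNNReal _ (sq_nonneg (P.xi j))]

instance (P : Params) (j : LinkType) : SigmaFinite (intensity P j) :=
  SigmaFinite.withDensity_ofReal _

/-- The propagation process has mean number of points `λ M_j(t)` in `[0, t]`. -/
theorem prod_loss_le (hlam : 0 < P.lam) (hp : 0 < P.p) (hp1 : P.p ≤ 1) (hD : 0 < P.D)
    (halpha : ∀ j, 0 < P.alpha j) (hxi : ∀ j, 0 < P.xi j) (j : LinkType) {t : ℝ} (ht : 0 < t) :
    0 ≤ P.lam * M P j t ∧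
    ((intensity P j).prod (gaussianReal 0 (P.xi j ^ 2).toNNReal)) {z | loss P j z.1 z.2 ≤ t} =
      ENNReal.ofReal (P.lam * M P j t) := by
  have hs := sigma_pos (hxi j)
  have hT : MeasurableSet {z : Plane × ℝ | loss P j z.1 z.2 ≤ t} :=
    measurableSet_le measurable_loss measurable_const
  set K : ℝ → ℝ := fun z => P.lam * diskMean P j (sqRadius P j t z) with hK
  have hKint : Integrable K (gaussianReal 0 1) ∧ ∫ z, K z ∂(gaussianReal 0 1) = P.lam * M P j t := by
    have hi1 := (integrable_min_sqRadius (P := P) (j := j) ht).const_mul (Real.pi * P.p)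
    have hi2 := (integrable_sqRadius (P := P) (j := j) t).const_mul Real.pi
    cases j with
    | LOS =>
      refine ⟨hi1.const_mul _, ?_⟩
      simp only [hK, diskMean]
      rw [integral_const_mul, integral_const_mul, integral_min_sqRadius hD (halpha _) hs ht, M]
    | NLOS =>
      refine ⟨(hi2.sub hi1).const_mul _, ?_⟩
      simp only [hK, diskMean]
      rw [integral_const_mul, integral_sub hi2 hi1, integral_const_mul, integral_const_mul,
        integral_min_sqRadius hD (halpha _) hs ht, integral_sqRadius, M]
      ring
  have hK0 : ∀ z, 0 ≤ K z := fun z =>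
    mul_nonneg hlam.le (diskMean_nonneg hp hp1 j (sqRadius_nonneg ht z))
  -- Nonnegativity is kept separately because `ENNReal.ofReal` would hide a negative value.
  refine ⟨hKint.2 ▸ integral_nonneg hK0, ?_⟩
  rw [Measure.prod_apply_symm hT, gaussianReal_shadowing,
    lintegral_map (measurable_measure_prodMk_right hT) (by fun_prop), ← hKint.2,
    ofReal_integral_eq_lintegral_ofReal hKint.1 (ae_of_all _ hK0)]
  refine lintegral_congr fun z => ?_
  have : (fun x => (x, -P.xi j * z)) ⁻¹' {z : Plane × ℝ | loss P j z.1 z.2 ≤ t} =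
      {x | loss P j x (-P.xi j * z) ≤ t} := rfl
  rw [this, setOf_loss_le (halpha j) ht, intensity_closedBall hlam hp hp1 hD j
    (Real.rpow_nonneg (mul_pos ht (gain_pos _)).le _), sqRadius_eq ht]

end Params

/-! ### The point of the propagation process nearest to the origin -/

section Nearest

variable {Ω : Type*} [MeasurableSpace Ω] {μ : Measure Ω} {P : Params} {j : LinkType}
  {Φ : RandomPoints Ω Plane} {χ : ℕ → Ω → ℝ}

lemma B_pos (hlam : 0 < P.lam) (hp : 0 < P.p) (hD : 0 < P.D) (j : LinkType) : 0 < B P j := by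
  cases j with
  | LOS =>
    have : 0 < P.lam * Real.pi * P.p * P.D ^ 2 := by positivity
    rw [B, sub_pos, Real.exp_lt_one_iff]
    linarith
  | NLOS => exact one_pos

/-- The LOS process has finite total intensity, reached once `n ≥ D`; the NLOS intensity of the
disks grows to infinity. -/
lemma tendsto_exp_diskMean (hlam : 0 < P.lam) (j : LinkType) :
    Tendsto (fun n : ℕ => Real.exp (-(P.lam * diskMean P j ((n : ℝ) ^ 2)))) atTop
      (𝓝 (1 - B P j)) := by
  have hev : ∀ᶠ n : ℕ in atTop, min ((n : ℝ) ^ 2) (P.D ^ 2) = P.D ^ 2 := by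
    filter_upwards [tendsto_natCast_atTop_atTop.eventually_ge_atTop |P.D|] with n hn
    exact min_eq_right (sq_le_sq.2 (hn.trans (le_abs_self _)))
  cases j with
  | LOS =>
    refine tendsto_const_nhds.congr' ?_
    filter_upwards [hev] with n hn
    rw [diskMean, hn, B]
    ring_nf
  | NLOS =>
    rw [B, sub_self]
    refine Real.tendsto_exp_neg_atTop_nhds_zero.comp ?_
    refine Tendsto.const_mul_atTop hlam ?_
    have h1 : Tendsto (fun n : ℕ => Real.pi * (n : ℝ) ^ 2 - Real.pi * P.p * P.D ^ 2) atTop atTop :=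
      tendsto_atTop_add_const_right _ _ (Tendsto.const_mul_atTop Real.pi_pos
        ((tendsto_pow_atTop two_ne_zero).comp tendsto_natCast_atTop_atTop))
    refine h1.congr' ?_
    filter_upwards [hev] with n hn
    rw [diskMean, hn]

lemma nonemptyEvent_eq {Ω : Type*} {Φ : RandomPoints Ω Plane} {χ : ℕ → Ω → ℝ} :
    nonemptyEvent P j Φ χ = (Φ.voidEvent χ univ)ᶜ := by
  ext ω
  simp only [nonemptyEvent, propagation, RandomPoints.voidEvent, Set.Nonempty, mem_ofPred_eq,
    mem_univ, not_true, mem_compl_iff, not_forall]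
  exact ⟨fun ⟨_, n, hn, _⟩ => ⟨n, hn, not_false⟩, fun ⟨n, hn, _⟩ => ⟨_, n, hn, rfl⟩⟩

lemma propagation_eq_empty {Ω : Type*} {Φ : RandomPoints Ω Plane} {χ : ℕ → Ω → ℝ} {ω : Ω}
    (hω : ω ∈ Φ.voidEvent χ univ) : propagation P j Φ χ ω = ∅ := by
  refine not_nonempty_iff_eq_empty.1 fun hne => ?_
  have hne' : ω ∈ nonemptyEvent P j Φ χ := hne
  rw [nonemptyEvent_eq] at hne'
  exact hne' hω

lemma measurableSet_nonemptyEvent (h : IsBSProcess P j Φ χ μ) :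
    MeasurableSet (nonemptyEvent P j Φ χ) := by
  rw [nonemptyEvent_eq]
  exact (h.marking.measurableSet_void h.poisson .univ).compl

/-- The whole plane may have infinite intensity, outside the scope of `IsIndepMarking.measure_void`,
so emptiness is the decreasing limit of void events of disks of radius `n`. -/
theorem measure_nonemptyEvent [IsProbabilityMeasure μ] (hlam : 0 < P.lam) (hp : 0 < P.p)
    (hp1 : P.p ≤ 1) (hD : 0 < P.D) (h : IsBSProcess P j Φ χ μ) :
    μ (nonemptyEvent P j Φ χ) = ENNReal.ofReal (B P j) := by
  set ν := gaussianReal 0 (P.xi j ^ 2).toNNReal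
  let A : ℕ → Set (Plane × ℝ) := fun n => Metric.closedBall 0 n ×ˢ univ
  have hA : ∀ n, MeasurableSet (A n) := fun n =>
    Metric.isClosed_closedBall.measurableSet.prod .univ
  have hprod : ∀ n, ((intensity P j).prod ν) (A n) =
      ENNReal.ofReal (P.lam * diskMean P j ((n : ℝ) ^ 2)) := fun n => by
    rw [Measure.prod_prod, measure_univ, mul_one,
      intensity_closedBall hlam hp hp1 hD j (Nat.cast_nonneg n)]
  have hvoid : ∀ n, μ (Φ.voidEvent χ (A n)) =
      ENNReal.ofReal (Real.exp (-(P.lam * diskMean P j ((n : ℝ) ^ 2)))) := fun n => by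
    rw [h.marking.measure_void h.poisson (hA n) (by rw [hprod]; exact ENNReal.ofReal_ne_top),
      hprod, ENNReal.toReal_ofReal
        (mul_nonneg hlam.le (diskMean_nonneg hp hp1 j (sq_nonneg _)))]
  have hInter : Φ.voidEvent χ univ = ⋂ n, Φ.voidEvent χ (A n) := by
    ext ω
    simp only [RandomPoints.voidEvent, mem_ofPred_eq, mem_iInter]
    refine ⟨fun hω n k hk => absurd (mem_univ _) (hω k hk), fun hω k hk _ => ?_⟩
    obtain ⟨n, hn⟩ := exists_nat_ge ‖Φ.pt k ω‖
    exact hω n k hk ⟨by simpa using hn, mem_univ _⟩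
  have hanti : Antitone fun n => Φ.voidEvent χ (A n) := fun n n' hn ω hω k hk hmem =>
    hω k hk ⟨Metric.closedBall_subset_closedBall (by exact_mod_cast hn) hmem.1, mem_univ _⟩
  have hlim := tendsto_measure_iInter_atTop (μ := μ)
    (fun n => (h.marking.measurableSet_void h.poisson (hA n)).nullMeasurableSet) hanti
    ⟨0, measure_ne_top _ _⟩
  have hV : μ (Φ.voidEvent χ univ) = ENNReal.ofReal (1 - B P j) := by
    rw [hInter]
    refine tendsto_nhds_unique hlim ?_
    simp only [Function.comp_def, hvoid]
    exact (ENNReal.continuous_ofReal.tendsto _).comp (tendsto_exp_diskMean hlam j)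
  have hB1 : B P j ≤ 1 := by
    cases j with
    | LOS => rw [B]; linarith [Real.exp_pos (-(P.lam * Real.pi * P.p * P.D ^ 2))]
    | NLOS => exact le_rfl
  rw [nonemptyEvent_eq, prob_compl_eq_one_sub (h.marking.measurableSet_void h.poisson .univ), hV,
    ← ENNReal.ofReal_one, ← ENNReal.ofReal_sub _ (by linarith)]
  congr 1
  ring

lemma bddBelow_propagation {Ω : Type*} {Φ : RandomPoints Ω Plane} {χ : ℕ → Ω → ℝ} (ω : Ω) :
    BddBelow (propagation P j Φ χ ω) :=
  ⟨0, by rintro l ⟨n, _, rfl⟩; exact loss_nonneg _ _⟩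

lemma measurable_nearest (h : IsBSProcess P j Φ χ μ) : Measurable (nearest P j Φ χ) := by
  refine measurable_of_Iio fun t => ?_
  -- On the void event `nearest` has the default value `sInf ∅ = 0`.
  have : nearest P j Φ χ ⁻¹' Iio t = (Φ.voidEvent χ univ ∩ {_ω | 0 < t}) ∪
      ⋃ n : ℕ, {ω | (n : ℕ∞) < Φ.num ω ∧ (Φ.pt n ω, χ n ω) ∈
        {z : Plane × ℝ | loss P j z.1 z.2 < t}} := by
    ext ω
    simp only [mem_preimage, mem_Iio, mem_union, mem_inter_iff, mem_iUnion, mem_ofPred_eq]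
    constructor
    · intro hlt
      by_cases hV : ω ∈ Φ.voidEvent χ univ
      · refine Or.inl ⟨hV, ?_⟩
        rwa [nearest, propagation_eq_empty hV, Real.sInf_empty] at hlt
      · rw [← mem_compl_iff, ← nonemptyEvent_eq (P := P) (j := j)] at hV
        obtain ⟨l, ⟨n, hn, rfl⟩, hl⟩ := (csInf_lt_iff (bddBelow_propagation ω) hV).1 hlt
        exact Or.inr ⟨n, hn, hl⟩
    · rintro (⟨hV, ht⟩ | ⟨n, hn, hl⟩)
      · rwa [nearest, propagation_eq_empty hV, Real.sInf_empty]
      · exact (csInf_le (bddBelow_propagation ω) ⟨n, hn, rfl⟩).trans_lt hl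
  rw [this]
  exact ((h.marking.measurableSet_void h.poisson .univ).inter (.const _)).union
    (.iUnion fun n => measurableSet_point_mem h.poisson h.marking
      (measurableSet_lt measurable_loss measurable_const) n)

section Standing

variable (hlam : 0 < P.lam) (hp : 0 < P.p) (hp1 : P.p ≤ 1) (hD : 0 < P.D)
  (halpha : ∀ j, 0 < P.alpha j) (hxi : ∀ j, 0 < P.xi j)
include hlam hp hp1 hD halpha hxi

theorem ae_isLeast_nearest [IsProbabilityMeasure μ] (h : IsBSProcess P j Φ χ μ) :
    ∀ᵐ ω ∂μ, ω ∈ nonemptyEvent P j Φ χ →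
      IsLeast (propagation P j Φ χ ω) (nearest P j Φ χ ω) := by
  -- Countably many levels suffice for one null set; `k + 1` keeps the level positive. The minimum
  -- over a nonempty finite sublevel set is then the global one.
  have hfin : ∀ᵐ ω ∂μ, ∀ k : ℕ, {n : ℕ | (n : ℕ∞) < Φ.num ω ∧
      (Φ.pt n ω, χ n ω) ∈ {z : Plane × ℝ | loss P j z.1 z.2 ≤ k + 1}}.Finite :=
    ae_all_iff.2 fun k => h.marking.ae_finite h.poisson
      (measurableSet_le measurable_loss measurable_const) (by
        rw [(prod_loss_le hlam hp hp1 hD halpha hxi j (by positivity)).2]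
        exact ENNReal.ofReal_ne_top)
  filter_upwards [hfin] with ω hω hne
  obtain ⟨_, n, hn, rfl⟩ := hne
  obtain ⟨k, hk⟩ := exists_nat_ge (loss P j (Φ.pt n ω) (χ n ω))
  obtain ⟨i, hi, hmin⟩ := (hω k).exists_minimalFor (fun i => loss P j (Φ.pt i ω) (χ i ω)) _
    ⟨n, hn, by simpa using hk.trans (by linarith)⟩
  have hleast : IsLeast (propagation P j Φ χ ω) (loss P j (Φ.pt i ω) (χ i ω)) := by
    refine ⟨⟨i, hi.1, rfl⟩, ?_⟩
    rintro _ ⟨l, hl, rfl⟩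
    rcases le_total (loss P j (Φ.pt i ω) (χ i ω)) (loss P j (Φ.pt l ω) (χ l ω)) with h' | h'
    · exact h'
    · exact hmin ⟨hl, h'.trans hi.2⟩ h'
  rwa [nearest, hleast.csInf_eq]

lemma measure_nearest_le [IsProbabilityMeasure μ] (h : IsBSProcess P j Φ χ μ) {t : ℝ}
    (ht : 0 < t) :
    μ (nonemptyEvent P j Φ χ ∩ nearest P j Φ χ ⁻¹' Iic t) =
      ENNReal.ofReal (1 - Real.exp (-(P.lam * M P j t))) := by
  have hT : MeasurableSet {z : Plane × ℝ | loss P j z.1 z.2 ≤ t} :=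
    measurableSet_le measurable_loss measurable_const
  obtain ⟨h0, hprod⟩ := prod_loss_le hlam hp hp1 hD halpha hxi j ht
  -- The equality is only almost sure: an infimum equal to `t` needs to be attained to yield a point
  -- of loss at most `t`.
  have hae : (nonemptyEvent P j Φ χ ∩ nearest P j Φ χ ⁻¹' Iic t : Set Ω) =ᵐ[μ]
      ((Φ.voidEvent χ {z : Plane × ℝ | loss P j z.1 z.2 ≤ t})ᶜ : Set Ω) := by
    filter_upwards [ae_isLeast_nearest hlam hp hp1 hD halpha hxi h] with ω hω
    refine propext ⟨fun ⟨hne, hle⟩ hV => ?_, fun hV => ?_⟩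
    · obtain ⟨n, hn, hl⟩ := (hω hne).1
      exact hV n hn (le_of_eq_of_le hl.symm hle)
    · have : ∃ n : ℕ, (n : ℕ∞) < Φ.num ω ∧ loss P j (Φ.pt n ω) (χ n ω) ≤ t := by
        by_contra hcon
        exact hV fun n hn hmem => hcon ⟨n, hn, hmem⟩
      obtain ⟨n, hn, hl⟩ := this
      exact ⟨⟨_, n, hn, rfl⟩, (csInf_le (bddBelow_propagation ω) ⟨n, hn, rfl⟩).trans hl⟩
  rw [measure_congr hae, prob_compl_eq_one_sub (h.marking.measurableSet_void h.poisson hT),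
    h.marking.measure_void h.poisson hT (by rw [hprod]; exact ENNReal.ofReal_ne_top), hprod,
    ENNReal.toReal_ofReal h0, ← ENNReal.ofReal_one, ← ENNReal.ofReal_sub _ (Real.exp_pos _).le]

lemma cond_nearest_le [IsProbabilityMeasure μ] (h : IsBSProcess P j Φ χ μ) {t : ℝ}
    (ht : 0 < t) :
    (cond μ (nonemptyEvent P j Φ χ)).map (nearest P j Φ χ) (Iic t) =
      ENNReal.ofReal ((1 - Real.exp (-(P.lam * M P j t))) / B P j) := by
  rw [Measure.map_apply (measurable_nearest h) measurableSet_Iic,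
    cond_apply (measurableSet_nonemptyEvent h), measure_nonemptyEvent hlam hp hp1 hD h,
    measure_nearest_le hlam hp hp1 hD halpha hxi h ht, ENNReal.ofReal_div_of_pos
      (B_pos hlam hp hD j), mul_comm, div_eq_mul_inv]

/-! ### From the distribution function to the density. -/

lemma monotoneOn_M (j : LinkType) : MonotoneOn (M P j) (Ioi 0) := by
  intro s hs t ht hst
  obtain ⟨_, h1⟩ := prod_loss_le hlam hp hp1 hD halpha hxi j hs
  obtain ⟨h0, h2⟩ := prod_loss_le hlam hp hp1 hD halpha hxi j ht
  have : ENNReal.ofReal (P.lam * M P j s) ≤ ENNReal.ofReal (P.lam * M P j t) := by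
    rw [← h1, ← h2]
    exact measure_mono fun z (hz : _ ≤ s) => hz.trans hst
  exact le_of_mul_le_mul_left ((ENNReal.ofReal_le_ofReal_iff h0).1 this) hlam

/-- The sign is not read off the formula: `λ M_j(t)` is the measure of sets increasing with `t`, so
`M_j` is monotone. -/
lemma M'_nonneg (j : LinkType) {t : ℝ} (ht : 0 < t) : 0 ≤ M' P j t :=
  (hasDerivAt_M hp hD halpha hxi j ht).hasDerivWithinAt.nonneg_of_monotoneOn
    (by simpa using PerfectSpace.univ_preperfect.open_inter isOpen_Ioi t ⟨mem_Ioi.2 ht, mem_univ t⟩)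
    (monotoneOn_M hlam hp hp1 hD halpha hxi j)

/-- Continuity from above of the product measure replaces asymptotics of `Q`: a loss below every
positive level forces the point to be the origin, which has intensity zero. -/
lemma tendsto_M_zero (j : LinkType) :
    Tendsto (fun t => P.lam * M P j t) (𝓝[>] 0) (𝓝 0) := by
  set ρ := (intensity P j).prod (gaussianReal 0 (P.xi j ^ 2).toNNReal) with hρ
  have h := tendsto_measure_biInter_gt (μ := ρ) (a := (0 : ℝ))
    (s := fun t => {z : Plane × ℝ | loss P j z.1 z.2 ≤ t})
    (fun r _ => (measurableSet_le measurable_loss measurable_const).nullMeasurableSet)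
    (fun s t _ hst z (hz : _ ≤ s) => hz.trans hst)
    ⟨1, one_pos, by
      rw [(prod_loss_le hlam hp hp1 hD halpha hxi j one_pos).2]; exact ENNReal.ofReal_ne_top⟩
  have h0 : ρ (⋂ r > (0 : ℝ), {z : Plane × ℝ | loss P j z.1 z.2 ≤ r}) = 0 := by
    refine measure_mono_null (t := Metric.closedBall 0 0 ×ˢ univ) (fun z hz => ?_) ?_
    · simp only [mem_iInter, mem_ofPred_eq] at hz
      have hle : loss P j z.1 z.2 ≤ 0 := le_of_forall_gt_imp_ge_of_dense hz
      refine ⟨?_, mem_univ _⟩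
      rw [loss, div_le_iff₀ (gain_pos _), zero_mul] at hle
      have := (Real.rpow_eq_zero (norm_nonneg _) (halpha j).ne').1
        (le_antisymm hle (Real.rpow_nonneg (norm_nonneg _) _))
      simpa using this
    · rw [hρ, Measure.prod_prod, intensity_closedBall hlam hp hp1 hD j le_rfl]
      have : diskMean P j 0 = 0 := by
        have : min (0 : ℝ) (P.D ^ 2) = 0 := min_eq_left (sq_nonneg _)
        cases j <;> simp [diskMean, this]
      simp [this]
  rw [h0] at h
  have h2 := (ENNReal.tendsto_toReal ENNReal.zero_ne_top).comp h
  refine h2.congr' ?_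
  filter_upwards [self_mem_nhdsWithin] with t ht
  obtain ⟨h0, h1⟩ := prod_loss_le hlam hp hp1 hD halpha hxi j ht
  simp only [Function.comp_apply]
  rw [h1, ENNReal.toReal_ofReal h0]

lemma f_nonneg (j : LinkType) {t : ℝ} (ht : 0 < t) : 0 ≤ f P j t :=
  div_nonneg (mul_nonneg (mul_nonneg hlam.le (Real.exp_pos _).le)
    (M'_nonneg hlam hp hp1 hD halpha hxi j ht)) (B_pos hlam hp hD j).le

lemma lintegral_f (j : LinkType) {t : ℝ} (ht : 0 < t) :
    ∫⁻ s in Ioc 0 t, ENNReal.ofReal (f P j s) =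
      ENNReal.ofReal ((1 - Real.exp (-(P.lam * M P j t))) / B P j) := by
  let F : ℝ → ℝ := fun s => (1 - Real.exp (-(P.lam * M P j s))) / B P j
  -- The formula for `M` need not take its limiting value at 0, so `F` is replaced by 0 there; this
  -- makes it continuous on `[0, t]`.
  let G : ℝ → ℝ := (Ioi 0).indicator F
  have hGF : ∀ {s : ℝ}, 0 < s → G s = F s := fun hs => indicator_of_mem (mem_Ioi.2 hs) F
  have hG0 : G 0 = 0 := indicator_of_notMem (lt_irrefl _) F
  have hG : ∀ s, 0 < s → HasDerivAt G (f P j s) s := by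
    intro s hs
    have h1 : HasDerivAt F (f P j s) s := by
      refine (((((hasDerivAt_M hp hD halpha hxi j hs).const_mul P.lam).neg.exp).const_sub
        1).div_const (B P j)).congr_deriv ?_
      rw [f, Pi.neg_apply]
      ring
    refine h1.congr_of_eventuallyEq ?_
    filter_upwards [lt_mem_nhds hs] with r hr using hGF hr
  have hcont : ContinuousOn G (Icc 0 t) := by
    intro s hs
    rcases hs.1.eq_or_lt with rfl | hs0
    · refine ContinuousWithinAt.mono ?_ Icc_subset_Ici_self
      rw [← continuousWithinAt_Ioi_iff_Ici, ContinuousWithinAt, hG0]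
      have hlim : Tendsto F (𝓝[>] 0) (𝓝 ((1 - Real.exp (-0)) / B P j)) :=
        ((Real.continuous_exp.tendsto _).comp
          (tendsto_M_zero hlam hp hp1 hD halpha hxi j).neg).const_sub 1 |>.div_const _
      rw [neg_zero, Real.exp_zero, sub_self, zero_div] at hlim
      refine hlim.congr' ?_
      filter_upwards [self_mem_nhdsWithin] with r hr using (hGF hr).symm
    · exact (hG s hs0).continuousAt.continuousWithinAt
  -- Integrability up to 0 needs no bound on `f`: it is the nonnegative derivative of a function
  -- continuous on `[0, t]`.
  have hint : IntegrableOn (f P j) (Ioc 0 t) :=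
    intervalIntegral.integrableOn_deriv_of_nonneg hcont (fun s hs => hG s hs.1)
      fun s hs => f_nonneg hlam hp hp1 hD halpha hxi j hs.1
  rw [← ofReal_integral_eq_lintegral_ofReal hint, ← intervalIntegral.integral_of_le ht.le,
    intervalIntegral.integral_eq_sub_of_hasDerivAt_of_le ht.le hcont (fun s hs => hG s hs.1)
      ((intervalIntegrable_iff_integrableOn_Ioc_of_le ht.le).2 hint), hG0, hGF ht, sub_zero]
  exact (ae_restrict_iff' measurableSet_Ioc).2
    (ae_of_all _ fun s hs => f_nonneg hlam hp hp1 hD halpha hxi j hs.1)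

theorem map_nearest_cond [IsProbabilityMeasure μ] (h : IsBSProcess P j Φ χ μ) :
    (cond μ (nonemptyEvent P j Φ χ)).map (nearest P j Φ χ) =
      (volume.restrict (Ioi (0 : ℝ))).withDensity (fun t => ENNReal.ofReal (f P j t)) := by
  refine Measure.ext_of_Iic _ _ fun a => ?_
  rw [withDensity_apply _ measurableSet_Iic, Measure.restrict_restrict measurableSet_Iic,
    inter_comm, Ioi_inter_Iic]
  rcases lt_or_ge 0 a with ha | ha
  · rw [cond_nearest_le hlam hp hp1 hD halpha hxi h ha,
      lintegral_f hlam hp hp1 hD halpha hxi j ha]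
  -- For `a ≤ 0` the mass of `Iic a` is at most that of `Iic t` for every `t > 0`, which tends to 0.
  · rw [Ioc_eq_empty (not_lt.2 ha), Measure.restrict_empty, lintegral_zero_measure]
    have hlim : Tendsto (fun t => ENNReal.ofReal ((1 - Real.exp (-(P.lam * M P j t))) / B P j))
        (𝓝[>] 0) (𝓝 (ENNReal.ofReal ((1 - Real.exp (-0)) / B P j))) :=
      (ENNReal.continuous_ofReal.tendsto _).comp
        (((Real.continuous_exp.tendsto _).comp
          (tendsto_M_zero hlam hp hp1 hD halpha hxi j).neg).const_sub 1 |>.div_const _)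
    rw [neg_zero, Real.exp_zero, sub_self, zero_div, ENNReal.ofReal_zero] at hlim
    refine le_antisymm (ge_of_tendsto hlim ?_) zero_le
    filter_upwards [self_mem_nhdsWithin] with t ht
    rw [← cond_nearest_le hlam hp hp1 hD halpha hxi h ht]
    exact measure_mono (Iic_subset_Iic.2 (ha.trans (le_of_lt ht)))

end Standing

end Nearest

end MmWave

theorem lemma5 {Ω : Type*} [MeasurableSpace Ω] (μ : Measure Ω) [IsProbabilityMeasure μ]
    (P : MmWave.Params) (hlam : 0 < P.lam) (hp : 0 < P.p) (hp1 : P.p ≤ 1) (hD : 0 < P.D)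
    (halpha : ∀ j, 0 < P.alpha j) (hxi : ∀ j, 0 < P.xi j)
    (j : MmWave.LinkType) (Φ : MmWave.RandomPoints Ω MmWave.Plane) (χ : ℕ → Ω → ℝ)
    (hΦ : MmWave.IsBSProcess P j Φ χ μ) :
    -- `M'_j` is the derivative of `M_j`, and `B_j` is the probability of the conditioning event
    (∀ t : ℝ, 0 < t → HasDerivAt (MmWave.M P j) (MmWave.M' P j t) t) ∧
    μ (MmWave.nonemptyEvent P j Φ χ) = ENNReal.ofReal (MmWave.B P j) ∧
    0 < MmWave.B P j ∧
    -- given that the propagation process is not empty, it has a point nearest to the origin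
    (∀ᵐ ω ∂(ProbabilityTheory.cond μ (MmWave.nonemptyEvent P j Φ χ)),
      IsLeast (MmWave.propagation P j Φ χ ω) (MmWave.nearest P j Φ χ ω)) ∧
    -- and the distance of this point has, under the conditional law, the density `f_j` on `(0, ∞)`
    AEMeasurable (MmWave.nearest P j Φ χ)
      (ProbabilityTheory.cond μ (MmWave.nonemptyEvent P j Φ χ)) ∧
    (∀ t : ℝ, 0 < t → 0 ≤ MmWave.f P j t) ∧
    (ProbabilityTheory.cond μ (MmWave.nonemptyEvent P j Φ χ)).map (MmWave.nearest P j Φ χ) =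
      (volume.restrict (Set.Ioi (0 : ℝ))).withDensity
        (fun t => ENNReal.ofReal (MmWave.f P j t)) := by
  refine ⟨fun t ht => MmWave.hasDerivAt_M hp hD halpha hxi j ht,
    MmWave.measure_nonemptyEvent hlam hp hp1 hD hΦ, MmWave.B_pos hlam hp hD j, ?_,
    (MmWave.measurable_nearest hΦ).aemeasurable,
    fun t ht => MmWave.f_nonneg hlam hp hp1 hD halpha hxi j ht,
    MmWave.map_nearest_cond hlam hp hp1 hD halpha hxi hΦ⟩
  filter_upwards [cond_absolutelyContinuous.ae_le
    (MmWave.ae_isLeast_nearest hlam hp hp1 hD halpha hxi hΦ),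
    ae_cond_mem (MmWave.measurableSet_nonemptyEvent hΦ)] with ω h hω using h hω
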